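/- Let $k$ be an algebraically closed field of characteristic $p>0$, let $X$ be a projective variety over $k$ (an integral closed subscheme of some $\mathbf P^n_k$), let $L$ be an ample line bundle on $X$, and let $Z\subset X$ be a finite set of smooth closed points, with its reduced scheme structure and ideal sheaf $I_Z$. For $e\ge 1$ let $I_Z^{[p^e]}$ be the ideal sheaf generated by the $p^e$-th powers of local sections of $I_Z$. A line bundle $A$ on $X$ *separates $p^e$-Frobenius jets at $Z$* if the restriction map $$H^0(X,A)\to H^0\bigl(X,A\otimes\mathcal O_X/I_Z^{[p^e]}\bigr)$$ is surjective. Let $s_F(A;Z)$ be the largest $e\ge 1$ such that $A$ separates $p^e$-Frobenius jets at $Z$, with $s_F(A;Z)=0$ if there is no such $e$ and $s_F(A;Z)=\infty$ if there are arbitrarily large ones. The Frobenius-Seshadri constant of $L$ at $Z$ is $$\epsilon_F(L;Z)=\sup_{m\ge 1}\frac{p^{s_F(L^m;Z)}-1}{m}\in[0,\infty].$$ Then: (i) $\displaystyle \epsilon_F(L;Z)=\sup_{m,e}\frac{p^e-1}{m}$, where the supremum, in $[0,\infty]$, is over all pairs of integers $m,e\ge 1$ such that $L^m$ separates $p^e$-Frobenius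 jets at $Z$. (ii) For every real number $a<\epsilon_F(L;Z)$ there is an integer $e_0\ge 1$ such that for every integer $e\ge 1$ divisible by $e_0$ there is an integer $m\ge 1$ such that $L^m$ separates $p^e$-Frobenius jets at $Z$ and $\frac{p^e-1}{m}>a$. (When $\epsilon_F(L;Z)$ is finite, this says that for every $\delta>0$ the same holds with $a=\epsilon_F(L;Z)-\delta$.) (iii) $\displaystyle \epsilon_F(L;Z)=\limsup_{m\to\infty}\frac{p^{s_F(L^m;Z)}-1}{m}$. -/

import Mathlib

universe u

open CategoryTheory AlgebraicGeometry TopologicalSpace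

noncomputable section

namespace FrobeniusSeshadri

variable {X : Scheme.{u}}

/-! ### Sheaves of modules: structure sheaf, tensor products, line bundles -/

/-- The structure sheaf `𝒪_X`, as a sheaf of `𝒪_X`-modules. -/
def structureSheaf (X : Scheme.{u}) : X.Modules :=
  SheafOfModules.unit X.ringCatSheaf

/-- The underlying presheaf of modules of `M`, with the structure sheaf regarded as a presheaf of
commutative rings (this is what Mathlib's tensor product of presheaves of modules expects). -/
def toPre (M : X.Modules) :
    _root_.PresheafOfModules.{u} (X.presheaf ⋙ forget₂ CommRingCat.{u} RingCat.{u}) :=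
  (Scheme.Modules.toPresheafOfModules X).obj M

/-- The presheaf tensor product `U ↦ M(U) ⊗_{𝒪(U)} N(U)`. -/
def preTensor (M N : X.Modules) : X.PresheafOfModules :=
  PresheafOfModules.Monoidal.tensorObj (toPre M) (toPre N)

/-- The tensor product `M ⊗ N` of two sheaves of `𝒪_X`-modules: the sheaf associated with
`U ↦ M(U) ⊗_{𝒪(U)} N(U)`. -/
def tensor (M N : X.Modules) : X.Modules :=
  (PresheafOfModules.sheafification (𝟙 X.ringCatSheaf.obj)).obj (preTensor M N)

/-- The canonical map from the presheaf tensor product to the tensor product. -/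
def toTensor (M N : X.Modules) :
    preTensor M N ⟶ (Scheme.Modules.toPresheafOfModules X).obj (tensor M N) :=
  (PresheafOfModules.sheafificationAdjunction (𝟙 X.ringCatSheaf.obj)).unit.app (preTensor M N)

/-- The section `s ⊗ t` of `M ⊗ N` over `U`, for sections `s` of `M` and `t` of `N` over `U`. -/
def tmul {M N : X.Modules} {U : X.Opens} (s : Γ(M, U)) (t : Γ(N, U)) : Γ(tensor M N, U) :=
  ((toTensor M N).app (.op U)).hom
    (TensorProduct.tmul Γ(X, U) (M := (toPre M).obj (.op U)) (N := (toPre N).obj (.op U)) s t)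

/-- The tensor powers `L^m`, with `L^0 = 𝒪_X` and `L^(m+1) = L ⊗ L^m`. -/
def tensorPow (L : X.Modules) : ℕ → X.Modules
  | 0 => structureSheaf X
  | m + 1 => tensor L (tensorPow L m)

/-- `t ∈ Γ(M, U)` is a frame (a nowhere vanishing generator) of `M` over `U`: multiplication by
`t` is an isomorphism from `𝒪_U` to the restriction of `M` to `U`. -/
def IsFrame (M : X.Modules) (U : X.Opens) (t : Γ(M, U)) : Prop :=
  ∀ (V : X.Opens) (h : V ≤ U),
    Function.Bijective fun r : Γ(X, V) => r • M.presheaf.map (homOfLE h).op t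

/-- A line bundle: a sheaf of modules locally isomorphic to the structure sheaf. -/
def IsLineBundle (M : X.Modules) : Prop :=
  ∀ x : X, ∃ (U : X.Opens) (_ : x ∈ U) (t : Γ(M, U)), IsFrame M U t

/-- For a global section `s` of a line bundle `M`, the open set `X_s` of the points where `s` does
not vanish, that is, near which `s` generates `M`. -/
def nonvanishing (M : X.Modules) (s : Γ(M, ⊤)) : X.Opens :=
  sSup {V : X.Opens | IsFrame M V (M.presheaf.map (homOfLE le_top).op s)}

/-- A line bundle `L` on a quasi-compact scheme is ample if every point has an affine
neighbourhood of the form `X_s`, where `s` is a global section of some `L^n` with `n ≥ 1`. -/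
def IsAmple (L : X.Modules) : Prop :=
  CompactSpace X ∧
    ∀ x : X, ∃ n : ℕ, 1 ≤ n ∧ ∃ s : Γ(tensorPow L n, ⊤),
      x ∈ nonvanishing (tensorPow L n) s ∧ IsAffineOpen (nonvanishing (tensorPow L n) s)

/-! ### Projective schemes over a field and smooth points -/

attribute [local instance] MvPolynomial.gradedAlgebra

/-- Projective space `ℙ^n` over `k`. -/
def projSpace (k : Type u) [Field k] (n : ℕ) : Scheme.{u} :=
  Proj (MvPolynomial.homogeneousSubmodule (Fin (n + 1)) k)

/-- The structure morphism `ℙ^n ⟶ Spec k`. -/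
def projSpaceToSpec (k : Type u) [Field k] (n : ℕ) : projSpace k n ⟶ Spec (.of k) :=
  Proj.toSpecZero (MvPolynomial.homogeneousSubmodule (Fin (n + 1)) k) ≫
    Spec.map (CommRingCat.ofHom
      (algebraMap k (MvPolynomial.homogeneousSubmodule (Fin (n + 1)) k 0)))

/-- `f : X ⟶ Spec k` is projective: `X` is a closed subscheme of some projective space over
`k`. -/
def IsProjective {k : Type u} [Field k] (f : X ⟶ Spec (.of k)) : Prop :=
  ∃ (n : ℕ) (i : X ⟶ projSpace k n), IsClosedImmersion i ∧ i ≫ projSpaceToSpec k n = f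

/-- `x` is a smooth point of `X` over `S`: the morphism `f` is smooth in a neighbourhood
of `x`. -/
def IsSmoothPoint {S : Scheme.{u}} (f : X ⟶ S) (x : X) : Prop :=
  ∃ U : X.Opens, x ∈ U ∧ Smooth (U.ι ≫ f)

/-! ### Frobenius powers of ideal sheaves and separation of Frobenius jets -/

/-- Ideals generated by `q`-th powers are compatible with localization. -/
theorem map_span_pow {A B : Type*} [CommRing A] [CommRing B] [Algebra A B] (f : A)
    [IsLocalization.Away f B] (I : Ideal A) (q : ℕ) :
    (Ideal.span ((fun h => h ^ q) '' (I : Set A))).map (algebraMap A B) =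
      Ideal.span ((fun h => h ^ q) '' (I.map (algebraMap A B) : Set B)) := by
  rw [Ideal.map_span]
  apply le_antisymm
  · rw [Ideal.span_le]
    rintro _ ⟨_, ⟨h, hh, rfl⟩, rfl⟩
    exact Ideal.subset_span ⟨algebraMap _ _ h, Ideal.mem_map_of_mem _ hh, (map_pow _ _ _).symm⟩
  · rw [Ideal.span_le]
    rintro _ ⟨g, hg, rfl⟩
    obtain ⟨⟨h, s⟩, hs⟩ := (IsLocalization.mem_map_algebraMap_iff (Submonoid.powers f) B).1 hg
    have hu : IsUnit ((algebraMap A B s) ^ q) := (IsLocalization.map_units B s).pow q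
    refine (Ideal.mul_unit_mem_iff_mem _ hu).1 ?_
    have hgs : g ^ q * (algebraMap A B s) ^ q = algebraMap A B ((h : A) ^ q) := by
      rw [← mul_pow, hs, map_pow]
    simp only
    rw [hgs]
    exact Ideal.subset_span ⟨_, ⟨h, h.2, rfl⟩, rfl⟩

/-- The ideal sheaf `I^[q]` generated by the `q`-th powers of the local sections of `I`. If `X` has
characteristic `p` and `q = p ^ e`, this is the inverse image of `I` under the `e`-th iterate of
the absolute Frobenius; if `I` is locally generated by `(h_i)`, then `I^[q]` is locally generated
by `(h_i ^ q)`. -/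
def frobeniusPower (I : X.IdealSheafData) (q : ℕ) : X.IdealSheafData where
  ideal U := Ideal.span ((fun h => h ^ q) '' (I.ideal U : Set Γ(X, U)))
  map_ideal_basicOpen U f := by
    have hloc : IsLocalization.Away f Γ(X, X.basicOpen f) := U.2.isLocalization_basicOpen f
    have hI : I.ideal (X.affineBasicOpen f) =
        (I.ideal U).map (algebraMap Γ(X, U) Γ(X, X.basicOpen f)) :=
      (I.map_ideal_basicOpen U f).symm
    rw [hI]
    exact map_span_pow f (I.ideal U) q

/-- `𝒪_X / I` as a sheaf of `𝒪_X`-modules: the push-forward of the structure sheaf of the closed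
subscheme defined by `I`. -/
def quotientSheaf (I : X.IdealSheafData) : X.Modules :=
  (Scheme.Modules.pushforward I.subschemeι).obj (structureSheaf I.subscheme)

/-- The global section `1` of `𝒪_X / I`. -/
def quotientOne (I : X.IdealSheafData) : Γ(quotientSheaf I, ⊤) :=
  (1 : Γ(I.subscheme, I.subschemeι ⁻¹ᵁ ⊤))

/-- The restriction map `H⁰(X, A) → H⁰(X, A ⊗ 𝒪_X / I)`, `s ↦ s ⊗ 1`. -/
def restrictionMap (A : X.Modules) (I : X.IdealSheafData) (s : Γ(A, ⊤)) :
    Γ(tensor A (quotientSheaf I), ⊤) :=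
  tmul s (quotientOne I)

/-- `A` separates `p^e`-Frobenius jets at the reduced closed subscheme `Z`: with `I_Z` the ideal of
`Z`, the map `H⁰(X, A) → H⁰(X, A ⊗ 𝒪_X / I_Z^[p^e])` is surjective. -/
def SeparatesFrobeniusJets (p : ℕ) (A : X.Modules) (Z : Closeds X) (e : ℕ) : Prop :=
  Function.Surjective
    (restrictionMap A (frobeniusPower (Scheme.IdealSheafData.vanishingIdeal Z) (p ^ e)))

/-! ### The Frobenius-Seshadri constant -/

/-- `s_F(A; Z)`: the largest `e ≥ 1` such that `A` separates `p^e`-Frobenius jets at `Z`. It is `0`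
if there is no such `e`, and `⊤` if there are arbitrarily large ones. -/
def sF (p : ℕ) (A : X.Modules) (Z : Closeds X) : ℕ∞ :=
  ⨆ (e : ℕ) (_ : 1 ≤ e ∧ SeparatesFrobeniusJets p A Z e), (e : ℕ∞)

/-- The ratio `(p^{s_F(L^m; Z)} - 1) / m`, in `[0, ∞]`. -/
def jetRatio (p : ℕ) (L : X.Modules) (Z : Closeds X) (m : ℕ) : ENNReal :=
  (((p : ℕ∞) ^ sF p (tensorPow L m) Z - 1 : ℕ∞) : ENNReal) / (m : ENNReal)

/-- The Frobenius-Seshadri constant `ε_F(L; Z) = sup_{m ≥ 1} (p^{s_F(L^m; Z)} - 1) / m`,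
in `[0, ∞]`. -/
def epsilonF (p : ℕ) (L : X.Modules) (Z : Closeds X) : ENNReal :=
  ⨆ (m : ℕ) (_ : 1 ≤ m), jetRatio p L Z m

end FrobeniusSeshadri

end

/-!
The proof has two inputs: a product construction for Frobenius jets, and the existence of one power
of `L` that separates them.

Products. Suppose that `L ^ m` separates `p ^ e`-Frobenius jets at `Z` and that `L ^ m'` separates
`p ^ e'`-Frobenius jets. For sections `s'` of `L ^ m'` and `t` of `L ^ m`, the product
`s' * t ^ p ^ e'` is a section of `L ^ (m' + m * p ^ e')`. The sections `s'` realize all residue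
classes modulo `I_Z^[p^e']`, and, since the Frobenius is additive, the powers `t ^ p ^ e'` realize
the `p ^ e'`-th powers of all functions modulo `I_Z^[p^(e+e')]`. Successive approximation along the
nilpotent ideal generated by the `h ^ p ^ e'`, `h` in `I_Z`, shows that sums of such products
realize all residue classes modulo `I_Z^[p^(e+e')]`; this is `exists_sub_mem_idealPow_add` and
`SeparatesFrobeniusJets.add`. Iterating, with `q = p ^ e`, the line bundle
`L ^ (m * (1 + q + ⋯ + q ^ r))` separates `q ^ (r + 1)`-Frobenius jets, with the same ratio
`(q - 1) / m` (`SeparatesFrobeniusJets.geom_sum`, `geom_ratio_eq`). Hence a ratio that occurs for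
one pair `(m, e)` occurs for all multiples of `e`, and for arbitrarily large `m`. This gives (ii)
for nonnegative `a` and (iii); (i) only unwinds the definition of the largest `e`
(`epsilonF_eq_iSup`).

Existence. For negative `a`, (ii) asks for at least one power of `L` that separates Frobenius jets.
It comes from ampleness: a function on an affine open set `X_s` extends to a section of a power of
`L` after multiplication with a high power of `s`, and the coordinate ring of `X_s` modulo
`I_Z^[q]` is finite over the ground field by the Nullstellensatz, so that one power of `s` is
enough for all residue classes (`IsAmple.exists_separatesFrobeniusJets`).

To compute with sections of the sheaf-theoretic tensor powers, two reductions are made. A frame `t`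
of `M` identifies `N` with `M ⊗ N` by `n ↦ t ⊗ n` (`tmul_bijective`), because the presheaf tensor
product is already a sheaf there. Hence tensor powers of a line bundle have frames `t ^ m`, and the
surjectivity of the restriction to a subscheme supported on `Z` can be tested in affine charts
around the points of `Z` (`surjective_restrictionMap_iff`). And, `X` being integral, sections of
`L ^ m` are rational functions `s / τ ^ m`, for a fixed frame `τ` of `L` at the generic point
(`val`), so that the product of sections is the product in the function field.
-/

noncomputable section

namespace FrobeniusSeshadri

variable {X : Scheme.{u}}

/-! ### Sections of sheaves of modules -/

/-- The restriction of sections of `M` from `U` to `V ≤ U`, as an additive map. -/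
def res (M : X.Modules) {U V : X.Opens} (h : V ≤ U) : Γ(M, U) →+ Γ(M, V) :=
  (M.presheaf.map (homOfLE h).op).hom

/-- The restriction of functions from `U` to `V ≤ U`, as a ring homomorphism. -/
def resO {U V : X.Opens} (h : V ≤ U) : Γ(X, U) →+* Γ(X, V) :=
  (X.presheaf.map (homOfLE h).op).hom

theorem res_self (M : X.Modules) {U : X.Opens} (h : U ≤ U) (s : Γ(M, U)) : res M h s = s := by
  simp [res]

theorem res_res (M : X.Modules) {U V W : X.Opens} (h : V ≤ U) (h' : W ≤ V) (s : Γ(M, U)) :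
    res M h' (res M h s) = res M (h'.trans h) s := by
  have : (homOfLE (h'.trans h)).op = (homOfLE h).op ≫ (homOfLE h').op := rfl
  simp [res, this]

theorem resO_resO {U V W : X.Opens} (h : V ≤ U) (h' : W ≤ V) (s : Γ(X, U)) :
    resO h' (resO h s) = resO (h'.trans h) s := by
  have : (homOfLE (h'.trans h)).op = (homOfLE h).op ≫ (homOfLE h').op := rfl
  simp [resO, this]

theorem res_smul (M : X.Modules) {U V : X.Opens} (h : V ≤ U) (r : Γ(X, U)) (s : Γ(M, U)) :
    res M h (r • s) = resO h r • res M h s :=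
  Scheme.Modules.map_smul M (homOfLE h) r s

theorem eq_of_locally_eq (M : X.Modules) {U : X.Opens} (s t : Γ(M, U))
    (H : ∀ x ∈ U, ∃ (V : X.Opens) (h : V ≤ U), x ∈ V ∧ res M h s = res M h t) : s = t := by
  choose V h hx H using H
  refine TopCat.Sheaf.eq_of_locally_eq' (⟨M.presheaf, M.isSheaf⟩ : TopCat.Sheaf Ab X)
    (fun x : U => V x.1 x.2) U (fun x => homOfLE (h x.1 x.2)) ?_ s t fun x => H x.1 x.2
  intro x hxU
  exact Opens.mem_iSup.2 ⟨⟨x, hxU⟩, hx x hxU⟩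

theorem exists_glue (M : X.Modules) {ι : Type*} {U : X.Opens} (V : ι → X.Opens)
    (hV : ∀ i, V i ≤ U) (hU : ∀ x ∈ U, ∃ i, x ∈ V i) (s : ∀ i, Γ(M, V i))
    (H : ∀ i j, res M (inf_le_left : V i ⊓ V j ≤ V i) (s i) =
      res M (inf_le_right : V i ⊓ V j ≤ V j) (s j)) :
    ∃ t : Γ(M, U), ∀ i, res M (hV i) t = s i := by
  obtain ⟨t, ht, -⟩ := TopCat.Sheaf.existsUnique_gluing'
    (⟨M.presheaf, M.isSheaf⟩ : TopCat.Sheaf Ab X) V U (fun i => homOfLE (hV i))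
    (fun x hx => Opens.mem_iSup.2 (hU x hx)) s H
  exact ⟨t, ht⟩

/-! ### Sections of tensor products -/

section TensorProduct

variable {M N : X.Modules} {U V : X.Opens}

/-- The section `s ⊗ t` of the presheaf tensor product. -/
def preTmul (s : Γ(M, U)) (t : Γ(N, U)) : (preTensor M N).obj (.op U) :=
  TensorProduct.tmul Γ(X, U) (M := (toPre M).obj (.op U)) (N := (toPre N).obj (.op U)) s t

theorem tmul_add (s : Γ(M, U)) (t t' : Γ(N, U)) : tmul s (t + t') = tmul s t + tmul s t' := by
  unfold tmul
  erw [TensorProduct.tmul_add]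
  exact map_add ((toTensor M N).app (.op U)).hom _ _

theorem smul_tmul (r : Γ(X, U)) (s : Γ(M, U)) (t : Γ(N, U)) : tmul (r • s) t = r • tmul s t :=
  LinearMap.map_smul ((toTensor M N).app (.op U)).hom r (preTmul s t)

theorem tmul_smul (r : Γ(X, U)) (s : Γ(M, U)) (t : Γ(N, U)) : tmul s (r • t) = r • tmul s t :=
  have h : preTmul s (r • t) = preTmul (r • s) t :=
    (TensorProduct.smul_tmul (R := Γ(X, U)) (M := (toPre M).obj (.op U))
      (N := (toPre N).obj (.op U)) r s t).symm
  (congrArg _ h).trans (smul_tmul r s t)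

theorem res_tmul (h : V ≤ U) (s : Γ(M, U)) (t : Γ(N, U)) :
    res (tensor M N) h (tmul s t) = tmul (res M h s) (res N h t) :=
  (PresheafOfModules.naturality_apply (toTensor M N) (homOfLE h).op (preTmul s t)).symm

/-- Sections of the tensor product come locally from the presheaf tensor product. -/
theorem exists_local_preTensor (σ : Γ(tensor M N, U)) (x : X) (hx : x ∈ U) :
    ∃ (V : X.Opens) (h : V ≤ U) (_ : x ∈ V) (ξ : (preTensor M N).obj (.op V)),
      ((toTensor M N).app (.op V)).hom ξ = res (tensor M N) h σ := by
  have := Presheaf.imageSieve_mem (Opens.grothendieckTopology X)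
    (CategoryTheory.toSheafify (Opens.grothendieckTopology X) (preTensor M N).presheaf)
    (U := .op U) σ
  obtain ⟨V, i, ⟨ξ, hξ⟩, hV⟩ := this x hx
  exact ⟨V, leOfHom i, hV, ξ, hξ⟩

/-- Two sections of the presheaf tensor product with the same image in the tensor product agree
locally. -/
theorem exists_local_preTensor_eq (ξ ξ' : (preTensor M N).obj (.op U))
    (h : ((toTensor M N).app (.op U)).hom ξ = ((toTensor M N).app (.op U)).hom ξ')
    (x : X) (hx : x ∈ U) :
    ∃ (V : X.Opens) (h : V ≤ U) (_ : x ∈ V),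
      (preTensor M N).map (homOfLE h).op ξ = (preTensor M N).map (homOfLE h).op ξ' := by
  have := Presheaf.equalizerSieve_mem (Opens.grothendieckTopology X)
    (CategoryTheory.toSheafify (Opens.grothendieckTopology X) (preTensor M N).presheaf)
    (X := .op U) ξ ξ' h
  obtain ⟨V, i, hi, hV⟩ := this x hx
  exact ⟨V, leOfHom i, hV, hi⟩

theorem tmul_bijective_of_free {R A B : Type*} [CommRing R] [AddCommGroup A] [AddCommGroup B]
    [Module R A] [Module R B] (t : A) (ht : Function.Bijective fun r : R => r • t) :
    Function.Bijective fun b : B => TensorProduct.tmul R t b := by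
  let e : R ≃ₗ[R] A := LinearEquiv.ofBijective (LinearMap.toSpanSingleton R A t) ht
  have he : e 1 = t := one_smul _ _
  have h : (fun b : B => TensorProduct.tmul R t b) =
      (e.rTensor B) ∘ (TensorProduct.lid R B).symm := by
    funext b
    simp [he]
  rw [h]
  exact (e.rTensor B).bijective.comp (TensorProduct.lid R B).symm.bijective

theorem IsFrame.mono {t : Γ(M, U)} (ht : IsFrame M U t) (h : V ≤ U) :
    IsFrame M V (res M h t) := by
  intro W hW
  have := ht W (hW.trans h)
  change Function.Bijective fun r : Γ(X, W) => r • res M hW (res M h t)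
  rw [res_res]
  exact this

theorem IsFrame.bijective {t : Γ(M, U)} (ht : IsFrame M U t) :
    Function.Bijective fun r : Γ(X, U) => r • t := by
  have := ht U le_rfl
  change Function.Bijective fun r : Γ(X, U) => r • res M le_rfl t at this
  rwa [res_self] at this

theorem preTmul_bijective {t : Γ(M, U)} (ht : IsFrame M U t) :
    Function.Bijective fun n : Γ(N, U) => preTmul t n :=
  tmul_bijective_of_free (R := Γ(X, U)) (A := Γ(M, U)) (B := Γ(N, U)) t ht.bijective

/-- A frame `t` of `M` identifies `N` with `M ⊗ N`: the presheaf `V ↦ M(V) ⊗ N(V)` is already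
isomorphic to the sheaf `N` below the domain of `t`. -/
theorem tmul_bijective {t : Γ(M, U)} (ht : IsFrame M U t) :
    Function.Bijective fun n : Γ(N, U) => tmul t n := by
  -- Injectivity is needed on all smaller open sets, for the gluing in the proof of surjectivity.
  have inj : ∀ {W : X.Opens} (h : W ≤ U) (n n' : Γ(N, W)),
      tmul (res M h t) n = tmul (res M h t) n' → n = n' := by
    intro W h n n' hnn
    refine eq_of_locally_eq N n n' fun x hx => ?_
    obtain ⟨V, hV, hxV, H⟩ := exists_local_preTensor_eq _ _ hnn x hx
    refine ⟨V, hV, hxV, ?_⟩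
    have H' : preTmul (res M hV (res M h t)) (res N hV n) =
        preTmul (res M hV (res M h t)) (res N hV n') := H
    exact (preTmul_bijective ((ht.mono h).mono hV)).1 H'
  refine ⟨fun n n' h => inj le_rfl n n' (by simpa only [res_self] using h), fun σ => ?_⟩
  have loc : ∀ x : U, ∃ (V : X.Opens) (h : V ≤ U) (_ : x.1 ∈ V) (n : Γ(N, V)),
      tmul (res M h t) n = res (tensor M N) h σ := by
    intro x
    obtain ⟨V, h, hx, ξ, hξ⟩ := exists_local_preTensor σ x.1 x.2
    obtain ⟨n, rfl⟩ := (preTmul_bijective (N := N) (ht.mono h)).2 ξ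
    exact ⟨V, h, hx, n, hξ⟩
  choose V hV hx n hn using loc
  obtain ⟨m, hm⟩ := exists_glue N V hV (fun x hx' => ⟨⟨x, hx'⟩, hx ⟨x, hx'⟩⟩) n fun i j => by
    refine inj (inf_le_left.trans (hV i)) _ _ ?_
    have hi := congrArg (res (tensor M N) (inf_le_left : V i ⊓ V j ≤ V i)) (hn i)
    have hj := congrArg (res (tensor M N) (inf_le_right : V i ⊓ V j ≤ V j)) (hn j)
    rw [res_tmul, res_res, res_res] at hi hj
    rw [hi, hj]
  refine ⟨m, eq_of_locally_eq _ _ _ fun x hx' => ⟨V ⟨x, hx'⟩, hV _, hx _, ?_⟩⟩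
  rw [← hn, ← hm]
  exact res_tmul _ _ _

theorem IsFrame.tmul {t : Γ(M, U)} (ht : IsFrame M U t) {t' : Γ(N, U)} (ht' : IsFrame N U t') :
    IsFrame (tensor M N) U (tmul t t') := by
  intro V h
  have hb := (tmul_bijective (N := N) (ht.mono h)).comp (ht' V h)
  change Function.Bijective fun r : Γ(X, V) => r • res (tensor M N) h (FrobeniusSeshadri.tmul t t')
  rw [res_tmul]
  refine (Function.Bijective.of_comp_iff' Function.bijective_id _).1 ?_
  convert hb using 1
  funext r
  exact (tmul_smul r _ _).symm

end TensorProduct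

/-! ### Frames of tensor powers -/

/-- The function `1`, as a section of the structure sheaf. -/
def oneSection (U : X.Opens) : Γ(structureSheaf X, U) := (1 : Γ(X, U))

theorem isFrame_oneSection (U : X.Opens) : IsFrame (structureSheaf X) U (oneSection U) := by
  intro V h
  have h1 : (structureSheaf X).presheaf.map (homOfLE h).op (oneSection U) = oneSection V :=
    map_one (resO h)
  rw [h1]
  have : (fun r : Γ(X, V) => r • oneSection V) = fun r : Γ(X, V) => r := by
    funext r
    exact mul_one r
  rw [this]
  exact Function.bijective_id

/-- The section `t ^ m` of `L ^ m`. -/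
def powSection (L : X.Modules) {U : X.Opens} (t : Γ(L, U)) : ∀ m, Γ(tensorPow L m, U)
  | 0 => oneSection U
  | m + 1 => tmul t (powSection L t m)

theorem IsFrame.powSection {L : X.Modules} {U : X.Opens} {t : Γ(L, U)} (ht : IsFrame L U t) :
    ∀ m, IsFrame (tensorPow L m) U (powSection L t m)
  | 0 => isFrame_oneSection U
  | m + 1 => ht.tmul (ht.powSection m)

theorem res_powSection (L : X.Modules) {U V : X.Opens} (h : V ≤ U) (t : Γ(L, U)) :
    ∀ m, res (tensorPow L m) h (powSection L t m) = powSection L (res L h t) m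
  | 0 => map_one (resO h)
  | m + 1 => (res_tmul h t _).trans (congrArg _ (res_powSection L h t m))

theorem powSection_smul (L : X.Modules) {U : X.Opens} (r : Γ(X, U)) (t : Γ(L, U)) :
    ∀ m, powSection L (r • t) m = r ^ m • powSection L t m
  | 0 => by rw [pow_zero, one_smul]; rfl
  | m + 1 => by
    change tmul (r • t) (powSection L (r • t) m) = r ^ (m + 1) • tmul t (powSection L t m)
    rw [powSection_smul L r t m, smul_tmul, tmul_smul, smul_smul, pow_succ']

/-! ### Surjectivity of the restriction to a finite subscheme, in terms of frames -/

/-- The restriction of functions on `U` to the closed subscheme defined by `J`, as a section of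
`𝒪_X / J`. -/
def quotientMk (J : X.IdealSheafData) {U : X.Opens} (f : Γ(X, U)) : Γ(quotientSheaf J, U) :=
  (J.subschemeι.app U).hom f

theorem res_quotientOne (J : X.IdealSheafData) (U : X.Opens) :
    res (quotientSheaf J) (le_top : U ≤ ⊤) (quotientOne J) = quotientMk J 1 :=
  (map_one (J.subscheme.presheaf.map
    (((Opens.map J.subschemeι.base).map (homOfLE (le_top : U ≤ ⊤))).op)).hom).trans
    (map_one (J.subschemeι.app U).hom).symm

theorem smul_quotientMk (J : X.IdealSheafData) {U : X.Opens} (f g : Γ(X, U)) :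
    f • quotientMk J g = quotientMk J (f * g) :=
  (map_mul (J.subschemeι.app U).hom f g).symm

theorem quotientMk_surjective (J : X.IdealSheafData) {U : X.Opens} (hU : IsAffineOpen U) :
    Function.Surjective (quotientMk J : Γ(X, U) → Γ(quotientSheaf J, U)) :=
  J.subschemeι_app_surjective ⟨U, hU⟩

theorem quotientMk_eq_iff (J : X.IdealSheafData) {U : X.Opens} (hU : IsAffineOpen U)
    (f g : Γ(X, U)) : quotientMk J f = quotientMk J g ↔ f - g ∈ J.ideal ⟨U, hU⟩ := by
  rw [← J.ker_subschemeι_app ⟨U, hU⟩, RingHom.sub_mem_ker_iff]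
  rfl

theorem subsingleton_quotientSheaf (J : X.IdealSheafData) {U : X.Opens}
    (hU : ∀ x ∈ U, x ∉ J.support) : Subsingleton Γ(quotientSheaf J, U) := by
  have h : J.subschemeι ⁻¹ᵁ U = ⊥ := by
    ext x
    simp only [Opens.coe_bot, Set.mem_empty_iff_false, iff_false]
    intro hx
    refine hU _ hx ?_
    have : J.subschemeι x ∈ Set.range J.subschemeι := ⟨x, rfl⟩
    rwa [J.range_subschemeι] at this
  have : Subsingleton Γ(J.subscheme, J.subschemeι ⁻¹ᵁ U) := by
    rw [h]
    infer_instance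
  exact this

theorem subsingleton_tensor_quotientSheaf {A : X.Modules} (hA : IsLineBundle A)
    (J : X.IdealSheafData) {U : X.Opens} (hU : ∀ x ∈ U, x ∉ J.support) :
    Subsingleton Γ(tensor A (quotientSheaf J), U) := by
  refine ⟨fun s t => eq_of_locally_eq _ s t fun x hx => ?_⟩
  obtain ⟨V, hxV, T, hT⟩ := hA x
  refine ⟨U ⊓ V, inf_le_left, ⟨hx, hxV⟩, ?_⟩
  have := subsingleton_quotientSheaf J (U := U ⊓ V) fun y hy => hU y hy.1
  have := (tmul_bijective (N := quotientSheaf J)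
    (hT.mono (inf_le_right : U ⊓ V ≤ V))).surjective.subsingleton
  exact Subsingleton.elim _ _

theorem res_restrictionMap {A : X.Modules} (J : X.IdealSheafData) {U : X.Opens} (T : Γ(A, U))
    (s : Γ(A, ⊤)) (f : Γ(X, U)) (hf : res A le_top s = f • T) :
    res _ le_top (restrictionMap A J s) = tmul T (quotientMk J f) := by
  rw [restrictionMap, res_tmul, hf, res_quotientOne, smul_tmul, ← tmul_smul, smul_quotientMk,
    mul_one]

/-- If `J` is supported on `Z` and every point `z` of `Z` has an affine neighbourhood `U z`
containing no other point of `Z` and a frame `T z` of `A` on it, then the restriction of `A` to the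
subscheme defined by `J` is surjective on global sections if and only if all residue classes of
functions on the `U z` are realized simultaneously by one global section of `A`. -/
theorem surjective_restrictionMap_iff {A : X.Modules} (hA : IsLineBundle A) (Z : Set X)
    (hZ : IsClosed Z) (J : X.IdealSheafData) (hJ : ∀ x ∈ J.support, x ∈ Z)
    (U : Z → X.Opens) (hU : ∀ z, IsAffineOpen (U z)) (hzU : ∀ z : Z, z.1 ∈ U z)
    (hUZ : ∀ z : Z, ∀ x ∈ U z, x ∈ Z → x = z) (T : ∀ z, Γ(A, U z))
    (hT : ∀ z, IsFrame A (U z) (T z)) :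
    Function.Surjective (restrictionMap A J) ↔
      ∀ g : ∀ z, Γ(X, U z), ∃ s : Γ(A, ⊤), ∀ z, ∃ f : Γ(X, U z),
        res A le_top s = f • T z ∧ f - g z ∈ J.ideal ⟨U z, hU z⟩ := by
  let Zc : X.Opens := ⟨Zᶜ, hZ.isOpen_compl⟩
  constructor
  · intro hsurj g
    -- Glue the given residue classes with the zero section away from `Z`.
    let V : Option Z → X.Opens := fun i => i.elim Zc U
    let σ : ∀ i, Γ(tensor A (quotientSheaf J), V i) := fun i =>
      match i with
      | none => 0
      | some z => tmul (T z) (quotientMk J (g z))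
    obtain ⟨σ', hσ'⟩ := exists_glue (tensor A (quotientSheaf J)) (U := ⊤) V (fun i => le_top)
      (fun x _ => by
        by_cases hx : x ∈ Z
        · exact ⟨some ⟨x, hx⟩, hzU _⟩
        · exact ⟨none, hx⟩) σ (fun i j => by
        by_cases hij : i = j
        · subst hij
          rfl
        have : ∀ x ∈ V i ⊓ V j, x ∉ J.support := by
          rintro x ⟨hxi, hxj⟩ hx
          have hxZ := hJ x hx
          match i, j, hij, hxi, hxj with
          | none, _, _, hxi, _ => exact hxi hxZ
          | some _, none, _, _, hxj => exact hxj hxZ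
          | some z, some z', hij, hxi, hxj =>
            exact hij (congrArg some (Subtype.ext
              ((hUZ z x hxi hxZ).symm.trans (hUZ z' x hxj hxZ))))
        have := subsingleton_tensor_quotientSheaf hA J this
        exact Subsingleton.elim _ _)
    obtain ⟨s, hs⟩ := hsurj σ'
    refine ⟨s, fun z => ?_⟩
    obtain ⟨f, hf⟩ := (hT z).bijective.2 (res A le_top s)
    refine ⟨f, hf.symm, (quotientMk_eq_iff J (hU z) _ _).1 ?_⟩
    refine (tmul_bijective (hT z)).1 ?_
    have := hσ' (some z)
    rw [← hs] at this
    exact (res_restrictionMap J (T z) s f hf.symm).symm.trans this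
  · intro H σ
    have loc : ∀ z, ∃ g : Γ(X, U z), tmul (T z) (quotientMk J g) = res _ le_top σ := by
      intro z
      obtain ⟨q, hq⟩ := (tmul_bijective (N := quotientSheaf J) (hT z)).2 (res _ le_top σ)
      obtain ⟨g, rfl⟩ := quotientMk_surjective J (hU z) q
      exact ⟨g, hq⟩
    choose g hg using loc
    obtain ⟨s, hs⟩ := H g
    refine ⟨s, eq_of_locally_eq _ _ _ fun x _ => ?_⟩
    by_cases hx : x ∈ Z
    · refine ⟨U ⟨x, hx⟩, le_top, hzU _, ?_⟩
      obtain ⟨f, hf, hfg⟩ := hs ⟨x, hx⟩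
      rw [res_restrictionMap J _ s f hf, (quotientMk_eq_iff J (hU _) _ _).2 hfg]
      exact hg _
    · refine ⟨Zc, le_top, hx, ?_⟩
      have := subsingleton_tensor_quotientSheaf hA J (U := Zc) fun y hy hyJ => hy (hJ y hyJ)
      exact Subsingleton.elim _ _

/-! ### Frobenius powers of the ideal of a reduced closed subset -/

/-- The ideal of `Z` consists of the functions that vanish at all points of `Z`. Points outside of
`U` impose no condition, as `X.basicOpen f` is contained in `U`. -/
theorem mem_vanishingIdeal_iff (Z : Closeds X) (U : X.affineOpens) (f : Γ(X, U)) :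
    f ∈ (Scheme.IdealSheafData.vanishingIdeal Z).ideal U ↔ ∀ x ∈ Z, x ∉ X.basicOpen f := by
  have key : ∀ y : Spec Γ(X, U), U.2.fromSpec y ∈ X.basicOpen f ↔ f ∉ y.asIdeal := by
    intro y
    change y ∈ U.2.fromSpec ⁻¹ᵁ X.basicOpen f ↔ _
    rw [U.2.fromSpec_preimage_basicOpen]
    exact Iff.rfl
  change f ∈ PrimeSpectrum.vanishingIdeal _ ↔ _
  rw [PrimeSpectrum.mem_vanishingIdeal]
  constructor
  · intro H x hx hxf
    have hxU : x ∈ U.1 := X.basicOpen_le f hxf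
    obtain ⟨y, rfl⟩ : x ∈ Set.range U.2.fromSpec := by rwa [U.2.range_fromSpec]
    exact (key y).1 hxf (H y hx)
  · intro H y hy
    by_contra hf
    exact H _ hy ((key y).2 hf)

theorem mem_of_mem_support_frobeniusPower (Z : Closeds X) (q : ℕ) (hq : q ≠ 0) (x : X)
    (hx : x ∈ (frobeniusPower (Scheme.IdealSheafData.vanishingIdeal Z) q).support) : x ∈ Z := by
  obtain ⟨_, ⟨U, hU, rfl⟩, hxU, -⟩ :=
    X.isBasis_affineOpens.exists_subset_of_mem_open (Set.mem_univ x) isOpen_univ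
  change x ∈ (Scheme.IdealSheafData.vanishingIdeal Z).support
  rw [Scheme.IdealSheafData.mem_support_iff_of_mem (U := ⟨U, hU⟩) hxU,
    Scheme.mem_zeroLocus_iff] at hx ⊢
  intro f hf
  have := hx (f ^ q) (Ideal.subset_span ⟨f, hf, rfl⟩)
  rwa [Scheme.basicOpen_pow _ _ (Nat.pos_of_ne_zero hq)] at this

/-! ### Sections of a line bundle as rational functions -/

theorem mem_inf {U V : X.Opens} {x : X} (hU : x ∈ U) (hV : x ∈ V) : x ∈ U ⊓ V := ⟨hU, hV⟩

section RationalFunctions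

variable [IsIntegral X]

theorem genericPoint_mem {U : X.Opens} {x : X} (hx : x ∈ U) : genericPoint X ∈ U :=
  ((genericPoint_spec X).mem_open_set_iff U.isOpen).2 ⟨x, trivial, hx⟩

/-- The rational function defined by a function on a nonempty open set. -/
def toK {U : X.Opens} (hU : genericPoint X ∈ U) : Γ(X, U) →+* X.functionField :=
  (X.presheaf.germ U (genericPoint X) hU).hom

theorem toK_injective {U : X.Opens} (hU : genericPoint X ∈ U) :
    Function.Injective (toK hU) :=
  germ_injective_of_isIntegral X (genericPoint X) hU

theorem toK_resO {U V : X.Opens} (h : V ≤ U) (hV : genericPoint X ∈ V) (f : Γ(X, U)) :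
    toK hV (resO h f) = toK (h hV) f :=
  X.presheaf.germ_res_apply (homOfLE h) _ hV f

variable {M : X.Modules} {U₀ : X.Opens} {τ : Γ(M, U₀)} (hτ : IsFrame M U₀ τ)
  (h₀ : genericPoint X ∈ U₀)

/-- The rational function `s / τ`, for a section `s` and a frame `τ` of `M` over nonempty open
sets. -/
def val {V : X.Opens} (hV : genericPoint X ∈ V) (s : Γ(M, V)) : X.functionField :=
  toK (U := U₀ ⊓ V) (mem_inf h₀ hV)
    ((hτ.mono (inf_le_left : U₀ ⊓ V ≤ U₀)).bijective.2 (res M inf_le_right s)).choose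

variable {V W : X.Opens}

theorem val_eq_of_res_eq (hV : genericPoint X ∈ V) (s : Γ(M, V)) (hWV : W ≤ V) (hW₀ : W ≤ U₀)
    (hW : genericPoint X ∈ W) (r : Γ(X, W)) (h : res M hWV s = r • res M hW₀ τ) :
    val hτ h₀ hV s = toK hW r := by
  have hs := ((hτ.mono (inf_le_left : U₀ ⊓ V ≤ U₀)).bijective.2 (res M inf_le_right s)).choose_spec
  have hs' := congrArg (res M (le_inf hW₀ hWV)) hs
  rw [res_smul, res_res, res_res, h] at hs'
  rw [← (hτ.mono hW₀).bijective.1 hs', toK_resO]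
  rfl

theorem exists_val_eq (hV : genericPoint X ∈ V) (s : Γ(M, V)) :
    ∃ r : Γ(X, U₀ ⊓ V), res M inf_le_right s = r • res M inf_le_left τ ∧
      val hτ h₀ hV s = toK (mem_inf h₀ hV) r := by
  obtain ⟨r, hr⟩ := (hτ.mono (inf_le_left : U₀ ⊓ V ≤ U₀)).bijective.2 (res M inf_le_right s)
  exact ⟨r, hr.symm, val_eq_of_res_eq hτ h₀ hV s _ _ _ r hr.symm⟩

theorem val_res (h : W ≤ V) (hW : genericPoint X ∈ W) (s : Γ(M, V)) :
    val hτ h₀ hW (res M h s) = val hτ h₀ (h hW) s := by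
  obtain ⟨r, hr, hv⟩ := exists_val_eq hτ h₀ (h hW) s
  have hle : U₀ ⊓ W ≤ U₀ ⊓ V := inf_le_inf_left _ h
  have := congrArg (res M hle) hr
  rw [res_smul, res_res, res_res] at this
  rw [hv, val_eq_of_res_eq hτ h₀ hW (res M h s) inf_le_right inf_le_left (mem_inf h₀ hW)
    (resO hle r) (by rw [res_res, this]), toK_resO]

theorem val_add (hV : genericPoint X ∈ V) (s s' : Γ(M, V)) :
    val hτ h₀ hV (s + s') = val hτ h₀ hV s + val hτ h₀ hV s' := by
  obtain ⟨r, hr, hv⟩ := exists_val_eq hτ h₀ hV s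
  obtain ⟨r', hr', hv'⟩ := exists_val_eq hτ h₀ hV s'
  rw [hv, hv', ← map_add]
  exact val_eq_of_res_eq hτ h₀ hV _ _ _ _ _ (by rw [map_add, hr, hr', add_smul])

theorem val_smul (hV : genericPoint X ∈ V) (f : Γ(X, V)) (s : Γ(M, V)) :
    val hτ h₀ hV (f • s) = toK hV f * val hτ h₀ hV s := by
  obtain ⟨r, hr, hv⟩ := exists_val_eq hτ h₀ hV s
  rw [hv, ← toK_resO (inf_le_right : U₀ ⊓ V ≤ V) (mem_inf h₀ hV), ← map_mul]
  exact val_eq_of_res_eq hτ h₀ hV _ _ _ _ _ (by rw [res_smul, hr, mul_smul])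

theorem val_ne_zero {t : Γ(M, V)} (ht : IsFrame M V t) (hV : genericPoint X ∈ V) :
    val hτ h₀ hV t ≠ 0 := by
  intro h
  obtain ⟨r, hr, hv⟩ := exists_val_eq hτ h₀ hV t
  obtain ⟨r', hr'⟩ := (ht.mono (inf_le_right : U₀ ⊓ V ≤ V)).bijective.2 (res M inf_le_left τ)
  have h1 : r' * r = 1 := by
    refine (hτ.mono (inf_le_left : U₀ ⊓ V ≤ U₀)).bijective.1 ?_
    change (r' * r) • res M inf_le_left τ = (1 : Γ(X, U₀ ⊓ V)) • res M inf_le_left τ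
    rw [mul_smul, ← hr, one_smul]
    exact hr'
  have h2 := congrArg (toK (U := U₀ ⊓ V) (mem_inf h₀ hV)) h1
  rw [map_mul, ← hv, h, mul_zero, map_one] at h2
  exact zero_ne_one h2

theorem val_injective (hM : IsLineBundle M) (hV : genericPoint X ∈ V) :
    Function.Injective (val hτ h₀ hV : Γ(M, V) → X.functionField) := by
  intro s s' h
  refine eq_of_locally_eq M s s' fun x hx => ?_
  obtain ⟨U, hxU, t, ht⟩ := hM x
  have ht' := ht.mono (inf_le_right : V ⊓ U ≤ U)
  have hη : genericPoint X ∈ V ⊓ U := genericPoint_mem ⟨hx, hxU⟩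
  refine ⟨V ⊓ U, inf_le_left, ⟨hx, hxU⟩, ?_⟩
  rw [← val_res hτ h₀ (inf_le_left : V ⊓ U ≤ V) hη s,
    ← val_res hτ h₀ (inf_le_left : V ⊓ U ≤ V) hη s'] at h
  obtain ⟨f, hf⟩ := ht'.bijective.2 (res M inf_le_left s)
  obtain ⟨f', hf'⟩ := ht'.bijective.2 (res M inf_le_left s')
  simp only at hf hf'
  rw [← hf, ← hf', val_smul, val_smul] at h
  rw [← hf, ← hf', toK_injective hη (mul_right_cancel₀ (val_ne_zero hτ h₀ ht' hη) h)]

/-- A rational function that is locally the value of a section is the value of a section: the local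
sections glue because they are determined by their values. -/
theorem exists_val_eq_of_local (hM : IsLineBundle M) (hV : genericPoint X ∈ V)
    (y : X.functionField)
    (H : ∀ x ∈ V, ∃ (W : X.Opens) (_ : W ≤ V) (_ : x ∈ W) (hη : genericPoint X ∈ W)
      (s : Γ(M, W)), val hτ h₀ hη s = y) :
    ∃ s : Γ(M, V), val hτ h₀ hV s = y := by
  have H' : ∀ x : V, ∃ (W : X.Opens) (_ : W ≤ V) (_ : x.1 ∈ W) (hη : genericPoint X ∈ W)
      (s : Γ(M, W)), val hτ h₀ hη s = y := fun x => H x.1 x.2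
  choose W hWV hxW hη s hs using H'
  obtain ⟨t, ht⟩ := exists_glue M W hWV (fun x hx => ⟨⟨x, hx⟩, hxW ⟨x, hx⟩⟩) s fun i j => by
    refine val_injective hτ h₀ hM (V := W i ⊓ W j) (mem_inf (hη i) (hη j)) ?_
    rw [val_res hτ h₀, val_res hτ h₀, hs, hs]
  refine ⟨t, ?_⟩
  let i : V := ⟨genericPoint X, hV⟩
  rw [← val_res hτ h₀ (hWV i) (hη i), ht, hs]

end RationalFunctions

/-! ### Global sections of tensor powers as rational functions -/

theorem IsLineBundle.tensorPow {L : X.Modules} (hL : IsLineBundle L) (m : ℕ) :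
    IsLineBundle (tensorPow L m) := fun x => by
  obtain ⟨U, hx, t, ht⟩ := hL x
  exact ⟨U, hx, powSection L t m, ht.powSection m⟩

/-- If `s = f • t` for a frame `t`, then `s` does not vanish exactly where `f` is invertible. -/
theorem mem_nonvanishing_iff {M : X.Modules} {V : X.Opens} (s : Γ(M, ⊤)) {t : Γ(M, V)}
    (ht : IsFrame M V t) {f : Γ(X, V)} (hf : res M le_top s = f • t) {x : X} (hx : x ∈ V) :
    x ∈ nonvanishing M s ↔ x ∈ X.basicOpen f := by
  constructor
  · intro h
    obtain ⟨W, hW, hxW⟩ := Opens.mem_sSup.1 h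
    have h1 : IsFrame M W (res M le_top s) := hW
    obtain ⟨g, hg⟩ := (h1.mono (inf_le_left : W ⊓ V ≤ W)).bijective.2 (res M inf_le_right t)
    have hf' := congrArg (res M (inf_le_right : W ⊓ V ≤ V)) hf
    rw [res_smul, res_res] at hf'
    simp only [res_res] at hg
    have h2 : g * resO inf_le_right f = 1 := by
      refine (ht.mono (inf_le_right : W ⊓ V ≤ V)).bijective.1 ?_
      change (g * resO inf_le_right f) • res M inf_le_right t =
        (1 : Γ(X, W ⊓ V)) • res M inf_le_right t
      rw [mul_smul, ← hf', one_smul]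
      exact hg
    have h3 : X.basicOpen (resO (inf_le_right : W ⊓ V ≤ V) f) = W ⊓ V :=
      Scheme.basicOpen_of_isUnit _ (isUnit_iff_exists_inv'.2 ⟨g, h2⟩)
    have h4 : x ∈ X.basicOpen (resO (inf_le_right : W ⊓ V ≤ V) f) := h3.symm ▸ mem_inf hxW hx
    exact ((X.basicOpen_res f (homOfLE (inf_le_right : W ⊓ V ≤ V)).op).le h4).2
  · intro h
    refine Opens.mem_sSup.2 ⟨X.basicOpen f, ?_, h⟩
    intro W hW
    change Function.Bijective fun r : Γ(X, W) => r • res M hW (res M le_top s)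
    have hWV : W ≤ V := hW.trans (X.basicOpen_le f)
    have hf' := congrArg (res M hWV) hf
    rw [res_smul, res_res] at hf'
    rw [res_res, hf']
    have hu : IsUnit (resO hWV f) := by
      have := (RingedSpace.isUnit_res_basicOpen X.toRingedSpace f).map (resO hW)
      rwa [← resO_resO (X.basicOpen_le f) hW]
    obtain ⟨u, hu⟩ := hu
    have h5 := (ht.mono hWV).bijective.comp (Units.mulRight_bijective u)
    convert h5 using 1
    funext r
    change r • resO hWV f • res M hWV t = (r * u) • res M hWV t
    rw [mul_smul, hu]

section Powers

variable [IsIntegral X] {L : X.Modules} {U₀ : X.Opens} {τ : Γ(L, U₀)} (hτ : IsFrame L U₀ τ)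
  (h₀ : genericPoint X ∈ U₀) {V : X.Opens}

theorem val_powSection (hV : genericPoint X ∈ V) (t : Γ(L, V)) (m : ℕ) :
    val (hτ.powSection m) h₀ hV (powSection L t m) = val hτ h₀ hV t ^ m := by
  obtain ⟨r, hr, hv⟩ := exists_val_eq hτ h₀ hV t
  rw [hv, ← map_pow]
  exact val_eq_of_res_eq _ h₀ hV _ inf_le_right inf_le_left _ _
    (by rw [res_powSection, res_powSection, hr, powSection_smul])

/-- The rational functions `s / τ ^ m`, for the global sections `s` of `L ^ m`. -/
def globalVals (m : ℕ) : Set X.functionField :=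
  Set.range fun s : Γ(tensorPow L m, ⊤) =>
    val (hτ.powSection m) h₀ (V := ⊤) trivial s

theorem mem_globalVals_of_local (hL : IsLineBundle L) (m : ℕ) (y : X.functionField)
    (H : ∀ x : X, ∃ (W : X.Opens) (_ : x ∈ W) (hη : genericPoint X ∈ W) (t : Γ(L, W))
      (f : Γ(X, W)), toK hη f * val hτ h₀ hη t ^ m = y) :
    y ∈ globalVals hτ h₀ m := by
  refine exists_val_eq_of_local (hτ.powSection m) h₀ (hL.tensorPow m) (V := ⊤) trivial y
    fun x _ => ?_
  obtain ⟨W, hx, hη, t, f, hf⟩ := H x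
  exact ⟨W, le_top, hx, hη, f • powSection L t m, by
    rw [val_smul, val_powSection hτ, hf]⟩

theorem exists_toK_mul_of_section {m : ℕ} (s : Γ(tensorPow L m, ⊤)) {t : Γ(L, V)}
    (ht : IsFrame L V t) (hV : genericPoint X ∈ V) :
    ∃ f : Γ(X, V), res _ le_top s = f • powSection L t m ∧
      val (hτ.powSection m) h₀ (V := ⊤) trivial s = toK hV f * val hτ h₀ hV t ^ m := by
  obtain ⟨f, hf⟩ := (ht.powSection m).bijective.2 (res (tensorPow L m) le_top s)
  refine ⟨f, hf.symm, ?_⟩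
  rw [← val_res (hτ.powSection m) h₀ (le_top : V ≤ ⊤) hV, ← hf, val_smul, val_powSection]

theorem exists_toK_mul_eq {m : ℕ} {y : X.functionField} (hy : y ∈ globalVals hτ h₀ m)
    {t : Γ(L, V)} (ht : IsFrame L V t) (hV : genericPoint X ∈ V) :
    ∃ f : Γ(X, V), y = toK hV f * val hτ h₀ hV t ^ m := by
  obtain ⟨s, rfl⟩ := hy
  obtain ⟨f, -, hf⟩ := exists_toK_mul_of_section hτ h₀ s ht hV
  exact ⟨f, hf⟩

/-- An identity of rational functions `s / τ ^ m = f * (t / τ) ^ m` lifts to `s = f • t ^ m`. -/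
theorem res_eq_smul_of_val_eq (hL : IsLineBundle L) {m : ℕ} (s : Γ(tensorPow L m, ⊤))
    (t : Γ(L, V)) (hV : genericPoint X ∈ V) (f : Γ(X, V))
    (h : val (hτ.powSection m) h₀ (V := ⊤) trivial s = toK hV f * val hτ h₀ hV t ^ m) :
    res _ le_top s = f • powSection L t m := by
  refine val_injective (hτ.powSection m) h₀ (hL.tensorPow m) hV ?_
  rw [val_res, h, val_smul, val_powSection]

theorem globalVals_add {m : ℕ} {y y' : X.functionField} (hy : y ∈ globalVals hτ h₀ m)
    (hy' : y' ∈ globalVals hτ h₀ m) : y + y' ∈ globalVals hτ h₀ m := by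
  obtain ⟨s, rfl⟩ := hy
  obtain ⟨s', rfl⟩ := hy'
  exact ⟨s + s', val_add _ _ _ _ _⟩

theorem globalVals_smul {m : ℕ} {y : X.functionField} (hy : y ∈ globalVals hτ h₀ m)
    (f : Γ(X, ⊤)) : toK (U := ⊤) trivial f * y ∈ globalVals hτ h₀ m := by
  obtain ⟨s, rfl⟩ := hy
  exact ⟨f • s, val_smul _ _ _ _ _⟩

theorem globalVals_zero (m : ℕ) : (0 : X.functionField) ∈ globalVals hτ h₀ m := by
  have := val_smul (hτ.powSection m) h₀ (V := ⊤) trivial 0 0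
  exact ⟨_, this.trans (by rw [map_zero, zero_mul])⟩

theorem globalVals_mul (hL : IsLineBundle L) {m m' : ℕ} {y y' : X.functionField}
    (hy : y ∈ globalVals hτ h₀ m) (hy' : y' ∈ globalVals hτ h₀ m') :
    y * y' ∈ globalVals hτ h₀ (m + m') := by
  refine mem_globalVals_of_local hτ h₀ hL _ _ fun x => ?_
  obtain ⟨W, hx, t, ht⟩ := hL x
  have hη := genericPoint_mem hx
  obtain ⟨f, rfl⟩ := exists_toK_mul_eq hτ h₀ hy ht hη
  obtain ⟨f', rfl⟩ := exists_toK_mul_eq hτ h₀ hy' ht hη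
  exact ⟨W, hx, hη, t, f * f', by rw [map_mul, pow_add]; ring⟩

theorem globalVals_one (hL : IsLineBundle L) : (1 : X.functionField) ∈ globalVals hτ h₀ 0 := by
  refine mem_globalVals_of_local hτ h₀ hL _ _ fun x => ?_
  obtain ⟨W, hx, t, ht⟩ := hL x
  exact ⟨W, hx, genericPoint_mem hx, t, 1, by rw [map_one, pow_zero, mul_one]⟩

theorem globalVals_pow (hL : IsLineBundle L) {m : ℕ} {y : X.functionField}
    (hy : y ∈ globalVals hτ h₀ m) : ∀ k : ℕ, y ^ k ∈ globalVals hτ h₀ (m * k)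
  | 0 => by
    rw [pow_zero]
    exact globalVals_one hτ h₀ hL
  | k + 1 => by
    rw [pow_succ]
    exact globalVals_mul hτ h₀ hL (globalVals_pow hL hy k) hy

/-- A function on the open set where a section of `L ^ n` does not vanish becomes a section of
`L ^ (n * k)` after multiplication with the `k`-th power of the section, for all large `k`. -/
theorem exists_forall_mul_pow_mem_globalVals [CompactSpace X] (hL : IsLineBundle L) {n : ℕ}
    (s : Γ(tensorPow L n, ⊤)) {V : X.Opens} (hV : nonvanishing (tensorPow L n) s = V)
    (hη : genericPoint X ∈ V) (h : Γ(X, V)) :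
    ∃ k₀ : ℕ, ∀ k, k₀ ≤ k →
      toK hη h * val (hτ.powSection n) h₀ (V := ⊤) trivial s ^ k ∈ globalVals hτ h₀ (n * k) := by
  set y := val (hτ.powSection n) h₀ (V := ⊤) trivial s with hy
  have loc : ∀ x : X, ∃ (W : X.Opens) (_ : x ∈ W) (hηW : genericPoint X ∈ W) (t : Γ(L, W))
      (k₀ : ℕ), ∀ k, k₀ ≤ k → ∃ f : Γ(X, W),
        toK hηW f * val hτ h₀ hηW t ^ (n * k) = toK hη h * y ^ k := by
    intro x
    obtain ⟨W', hxW', t', ht'⟩ := hL x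
    obtain ⟨_, ⟨W, hW, rfl⟩, hxW, hWW'⟩ :=
      X.isBasis_affineOpens.exists_subset_of_mem_open (a := x) hxW' W'.isOpen
    have ht := ht'.mono (V := W) hWW'
    have hηW := genericPoint_mem (U := W) hxW
    obtain ⟨f, hf, hyf⟩ := exists_toK_mul_of_section hτ h₀ s ht hηW
    have hle : X.basicOpen f ≤ V := fun z hz => by
      rw [← hV]
      exact (mem_nonvanishing_iff s (ht.powSection n) hf (X.basicOpen_le f hz)).2 hz
    have hηf : genericPoint X ∈ X.basicOpen f := by
      refine (mem_nonvanishing_iff s (ht.powSection n) hf hηW).1 ?_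
      rwa [hV]
    have hloc : IsLocalization.Away f Γ(X, X.basicOpen f) :=
      IsAffineOpen.isLocalization_basicOpen hW f
    -- `V ⊓ W` is the basic open set of `f`, so `h` acquires only a power of `f` as denominator.
    obtain ⟨k₀, r, hr⟩ := IsLocalization.Away.surj f (resO hle h)
    refine ⟨W, hxW, hηW, res L hWW' t', k₀, fun k hk => ⟨f ^ (k - k₀) * r, ?_⟩⟩
    have hr' := congrArg (toK hηf) hr
    have hres : ∀ g : Γ(X, W), toK hηf (algebraMap _ _ g) = toK hηW g := fun g =>
      toK_resO (X.basicOpen_le f) hηf g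
    rw [map_mul, map_pow, hres, hres, toK_resO] at hr'
    rw [hy, hyf, mul_pow, ← pow_mul, map_mul, ← hr', map_pow]
    have : toK hηW f ^ k = toK hηW f ^ (k - k₀) * toK hηW f ^ k₀ := by
      rw [← pow_add, Nat.sub_add_cancel hk]
    rw [this]
    ring
  choose W hxW hηW t k₀ H using loc
  obtain ⟨F, hF⟩ := isCompact_univ.elim_finite_subcover (fun x => (W x : Set X))
    (fun x => (W x).isOpen) (fun x _ => Set.mem_iUnion.2 ⟨x, hxW x⟩)
  refine ⟨F.sup k₀, fun k hk => mem_globalVals_of_local hτ h₀ hL _ _ fun x => ?_⟩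
  obtain ⟨z, hz, hxz⟩ := Set.mem_iUnion₂.1 (hF (Set.mem_univ x))
  obtain ⟨f, hf⟩ := H z k ((Finset.le_sup hz).trans hk)
  exact ⟨W z, hxz, hηW z, t z, f, hf⟩

end Powers

/-! ### Frobenius powers of ideals in characteristic `p` -/

section Algebra

/-- The Frobenius power `I^[q]` of an ideal: the ideal generated by the `q`-th powers of the
elements of `I`. -/
def idealPow {R : Type*} [CommRing R] (I : Ideal R) (q : ℕ) : Ideal R :=
  Ideal.span ((fun h => h ^ q) '' (I : Set R))

variable {R : Type*} [CommRing R]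

theorem pow_mem_idealPow {I : Ideal R} {x : R} (hx : x ∈ I) (q : ℕ) : x ^ q ∈ idealPow I q :=
  Ideal.subset_span ⟨x, hx, rfl⟩

/-- In characteristic `p`, raising to the power `p ^ e` maps `I^[q]` into `I^[q * p ^ e]`. -/
theorem pow_mem_idealPow_mul (p : ℕ) [ExpChar R p] (I : Ideal R) (q e : ℕ) {x : R}
    (hx : x ∈ idealPow I q) : x ^ p ^ e ∈ idealPow I (q * p ^ e) := by
  induction hx using Submodule.span_induction with
  | mem x hx =>
    obtain ⟨h, hh, rfl⟩ := hx
    simp only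
    rw [← pow_mul]
    exact pow_mem_idealPow hh _
  | zero =>
    rw [zero_pow (pow_pos (expChar_pos R p) e).ne']
    exact zero_mem _
  | add x y _ _ hx hy =>
    rw [add_pow_expChar_pow]
    exact add_mem hx hy
  | smul a x _ hx =>
    rw [smul_eq_mul, mul_pow]
    exact Ideal.mul_mem_left _ _ hx

theorem mul_pow_mem_idealPow {I : Ideal R} {k q : ℕ} {u x : R} (hu : u ∈ idealPow I q)
    (hx : x ∈ I ^ k) : u * x ^ q ∈ idealPow (I ^ (k + 1)) q := by
  induction hu using Submodule.span_induction with
  | mem u hu =>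
    obtain ⟨h, hh, rfl⟩ := hu
    simp only
    rw [← mul_pow]
    refine pow_mem_idealPow ?_ q
    rw [pow_succ']
    exact Ideal.mul_mem_mul hh hx
  | zero => simp
  | add u v _ _ hu hv =>
    rw [add_mul]
    exact add_mem hu hv
  | smul a u _ hu =>
    rw [smul_eq_mul, mul_assoc]
    exact Ideal.mul_mem_left _ _ hu

theorem exists_pow_le_idealPow {I : Ideal R} (hI : I.FG) (q : ℕ) :
    ∃ k : ℕ, I ^ k ≤ idealPow I q :=
  Ideal.exists_pow_le_of_le_radical_of_fg (fun _ hx => ⟨q, pow_mem_idealPow hx q⟩) hI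

/-- The algebra behind the iteration of Frobenius jets. If a graded family `S` of sets of functions
on a finite disjoint union realizes all residue classes modulo `I^[p^e]` in degree `m`, and all
residue classes modulo `I^[p^e']` in degree `m'`, then it realizes all residue classes modulo
`I^[p^(e+e')]` in degree `m' + m * p ^ e'`.

The products `s' * t ^ p ^ e'`, with `s' ∈ S m'` and `t ∈ S m`, approximate `a * h ^ p ^ e'` for
all `a` and `h`. This reduces a residue class in `(I^k)^[p^e']` to one in `(I^(k+1))^[p^e']`,
modulo `I^[p^(e+e')]`, and a power of `I` lies in `I^[p^e]` because `I` is finitely generated. -/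
theorem exists_sub_mem_idealPow_add {ι : Type*} [Finite ι] {R : ι → Type*}
    [∀ i, CommRing (R i)] (p : ℕ) [∀ i, ExpChar (R i) p] (I : ∀ i, Ideal (R i))
    (hI : ∀ i, (I i).FG) (S : ℕ → Set (∀ i, R i)) (hzero : ∀ m, 0 ∈ S m)
    (hadd : ∀ m, ∀ f ∈ S m, ∀ g ∈ S m, f + g ∈ S m)
    (hmul : ∀ m, ∀ f ∈ S m, ∀ m', ∀ g ∈ S m', f * g ∈ S (m + m'))
    (hpow : ∀ m, ∀ f ∈ S m, ∀ k : ℕ, f ^ k ∈ S (m * k)) {m m' e e' : ℕ}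
    (h : ∀ g : ∀ i, R i, ∃ f ∈ S m, ∀ i, f i - g i ∈ idealPow (I i) (p ^ e))
    (h' : ∀ g : ∀ i, R i, ∃ f ∈ S m', ∀ i, f i - g i ∈ idealPow (I i) (p ^ e'))
    (g : ∀ i, R i) :
    ∃ f ∈ S (m' + m * p ^ e'), ∀ i, f i - g i ∈ idealPow (I i) (p ^ (e + e')) := by
  classical
  have := Fintype.ofFinite ι
  set W := S (m' + m * p ^ e') with hW
  let N : ℕ → ∀ i, Ideal (R i) := fun k i =>
    idealPow (I i ^ k) (p ^ e') ⊔ idealPow (I i) (p ^ (e + e'))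
  -- One step of the approximation, for a residue class supported on a single component.
  have step : ∀ (k : ℕ) (i : ι) (r : R i), r ∈ N k i →
      ∃ f ∈ W, ∀ j, f j - (Pi.single i r : ∀ i, R i) j ∈ N (k + 1) j := by
    intro k i r hr
    obtain ⟨r₁, hr₁, r₂, hr₂, rfl⟩ := Submodule.mem_sup.1 hr
    -- `W` is not an ideal, so the factor `a` has to be carried through the induction.
    have h1 : ∀ a, ∃ f ∈ W, ∀ j, f j - (Pi.single i (a * r₁) : ∀ i, R i) j ∈ N (k + 1) j := by
      clear hr hr₂
      induction hr₁ using Submodule.span_induction with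
      | mem x hx =>
        obtain ⟨x, hx, rfl⟩ := hx
        intro a
        obtain ⟨f, hf, hfa⟩ := h' (Pi.single i a)
        obtain ⟨t, ht, htx⟩ := h (Pi.single i x)
        refine ⟨f * t ^ p ^ e', hmul _ _ hf _ _ (hpow _ _ ht _), fun j => ?_⟩
        have hq : p ^ e' ≠ 0 := (pow_pos (expChar_pos (R i) p) e').ne'
        have hs : (Pi.single i (a * x ^ p ^ e') : ∀ i, R i) j =
            (Pi.single i a : ∀ i, R i) j * (Pi.single i x : ∀ i, R i) j ^ p ^ e' := by
          obtain rfl | hij := eq_or_ne j i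
          · simp only [Pi.single_eq_same]
          · simp only [Pi.single_eq_of_ne hij, zero_mul]
        have hsplit : (f * t ^ p ^ e') j - (Pi.single i (a * x ^ p ^ e') : ∀ i, R i) j =
            (f j - (Pi.single i a : ∀ i, R i) j) * (Pi.single i x : ∀ i, R i) j ^ p ^ e' +
              f j * (t j - (Pi.single i x : ∀ i, R i) j) ^ p ^ e' := by
          rw [hs, sub_pow_expChar_pow, Pi.mul_apply, Pi.pow_apply]
          ring
        rw [hsplit]
        refine add_mem (Ideal.mem_sup_left ?_) (Ideal.mem_sup_right (Ideal.mul_mem_left _ _ ?_))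
        · obtain rfl | hij := eq_or_ne j i
          · exact mul_pow_mem_idealPow (hfa j) (by rwa [Pi.single_eq_same])
          · rw [Pi.single_eq_of_ne (M := R) hij x, zero_pow hq, mul_zero]
            exact zero_mem _
        · rw [pow_add]
          exact pow_mem_idealPow_mul p (I j) _ e' (htx j)
      | zero => exact fun a => ⟨0, hzero _, fun j => by simp⟩
      | add x y _ _ hx hy =>
        intro a
        obtain ⟨f, hf, hfx⟩ := hx a
        obtain ⟨f', hf', hfy⟩ := hy a
        refine ⟨f + f', hadd _ _ hf _ hf', fun j => ?_⟩
        rw [mul_add, Pi.single_add, Pi.add_apply, Pi.add_apply, add_sub_add_comm]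
        exact add_mem (hfx j) (hfy j)
      | smul b x _ hx =>
        intro a
        rw [smul_eq_mul, ← mul_assoc]
        exact hx (a * b)
    obtain ⟨f, hf, hfr⟩ := h1 1
    refine ⟨f, hf, fun j => ?_⟩
    have hfr := hfr j
    rw [one_mul] at hfr
    rw [Pi.single_add, Pi.add_apply, ← sub_sub]
    refine sub_mem hfr (Ideal.mem_sup_right ?_)
    obtain rfl | hij := eq_or_ne j i
    · rwa [Pi.single_eq_same]
    · rw [Pi.single_eq_of_ne hij]
      exact zero_mem _
  have hsum : ∀ (F : Finset ι) (w : ι → ∀ i, R i), (∀ i, w i ∈ W) → ∑ i ∈ F, w i ∈ W := by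
    intro F w hw
    induction F using Finset.induction_on with
    | empty => exact hzero _
    | insert a F ha ih =>
      rw [Finset.sum_insert ha]
      exact hadd _ _ (hw a) _ ih
  have approx : ∀ k : ℕ, ∃ f ∈ W, ∀ i, f i - g i ∈ N k i := by
    intro k
    induction k with
    | zero =>
      refine ⟨0, hzero _, fun i => Ideal.mem_sup_left ?_⟩
      have h1 : (1 : R i) ∈ idealPow (I i ^ 0) (p ^ e') := by
        have := pow_mem_idealPow (I := I i ^ 0) (x := 1) (by simp) (p ^ e')
        rwa [one_pow] at this
      rw [(Ideal.eq_top_iff_one _).2 h1]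
      trivial
    | succ k ih =>
      obtain ⟨f, hf, hfg⟩ := ih
      choose w hw hwr using fun i => step k i (g i - f i)
        (by rw [← neg_sub]; exact neg_mem (hfg i))
      refine ⟨f + ∑ i, w i, hadd _ _ hf _ (hsum _ _ hw), fun j => ?_⟩
      have hj : (f + ∑ i, w i) j - g j =
          ∑ i, (w i j - (Pi.single i (g i - f i) : ∀ i, R i) j) := by
        rw [Finset.sum_sub_distrib, Pi.add_apply, Finset.sum_apply,
          Finset.sum_pi_single j (fun i => g i - f i), if_pos (Finset.mem_univ j)]
        ring
      rw [hj]
      exact sum_mem fun i _ => hwr i j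
  choose k hk using fun i => exists_pow_le_idealPow (hI i) (p ^ e)
  obtain ⟨f, hf, hfg⟩ := approx (∑ i, k i)
  refine ⟨f, hf, fun i => ?_⟩
  refine (sup_le ?_ le_rfl : N (∑ i, k i) i ≤ _) (hfg i)
  refine Ideal.span_le.2 ?_
  rintro _ ⟨x, hx, rfl⟩
  have hki : k i ≤ ∑ i, k i := Finset.single_le_sum (fun _ _ => Nat.zero_le _) (Finset.mem_univ i)
  have := pow_mem_idealPow_mul p (I i) _ e' (hk i (Ideal.pow_le_pow_right hki hx))
  rwa [← pow_add] at this

end Algebra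

/-! ### Frobenius jets in terms of rational functions -/

section Charts

/-- An affine neighbourhood of a point `z` of `Z` that contains no other point of `Z`, with a frame
of `L` on it. -/
structure Chart (L : X.Modules) (Z : Closeds X) (z : X) where
  /-- The affine neighbourhood of `z`. -/
  U : X.Opens
  isAffineOpen : IsAffineOpen U
  mem : z ∈ U
  eq_of_mem : ∀ x ∈ U, x ∈ Z → x = z
  /-- The frame of `L`. -/
  t : Γ(L, U)
  isFrame : IsFrame L U t

variable {L : X.Modules} {Z : Closeds X}

/-- The ideal of the point `z` in the coordinate ring of a chart at `z`. -/
def Chart.ideal {z : X} (C : Chart L Z z) : Ideal Γ(X, C.U) :=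
  (Scheme.IdealSheafData.vanishingIdeal Z).ideal ⟨C.U, C.isAffineOpen⟩

theorem Chart.mem_ideal_iff {z : X} (hz : z ∈ Z) (C : Chart L Z z) (f : Γ(X, C.U)) :
    f ∈ C.ideal ↔ z ∉ X.basicOpen f := by
  rw [Chart.ideal, mem_vanishingIdeal_iff]
  exact ⟨fun H => H z hz, fun H x hx hxf => H (C.eq_of_mem x (X.basicOpen_le f hxf) hx ▸ hxf)⟩

variable [IsIntegral X]

theorem Chart.genericPoint_mem {z : X} (C : Chart L Z z) : genericPoint X ∈ C.U :=
  FrobeniusSeshadri.genericPoint_mem C.mem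

variable {U₀ : X.Opens} {τ : Γ(L, U₀)} (hτ : IsFrame L U₀ τ) (h₀ : genericPoint X ∈ U₀)

/-- The rational function `t / τ`, for the frame `t` of a chart. -/
def Chart.coeff {z : X} (C : Chart L Z z) : X.functionField :=
  val hτ h₀ C.genericPoint_mem C.t

theorem Chart.coeff_ne_zero {z : X} (C : Chart L Z z) : C.coeff hτ h₀ ≠ 0 :=
  val_ne_zero hτ h₀ C.isFrame _

variable (C : ∀ z : (Z : Set X), Chart L Z z)

/-- The families of functions that describe, in the charts, the global sections of `L ^ m`. -/
def chartVals (m : ℕ) : Set (∀ z : (Z : Set X), Γ(X, (C z).U)) :=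
  {f | ∃ y ∈ globalVals hτ h₀ m,
    ∀ z, y = toK (C z).genericPoint_mem (f z) * (C z).coeff hτ h₀ ^ m}

theorem exists_mem_chartVals {m : ℕ} {y : X.functionField} (hy : y ∈ globalVals hτ h₀ m) :
    ∃ f ∈ chartVals hτ h₀ C m,
      ∀ z, y = toK (C z).genericPoint_mem (f z) * (C z).coeff hτ h₀ ^ m := by
  choose f hf using fun z => exists_toK_mul_eq hτ h₀ hy (C z).isFrame (C z).genericPoint_mem
  exact ⟨f, ⟨y, hy, hf⟩, hf⟩

theorem chartVals_zero (m : ℕ) : 0 ∈ chartVals hτ h₀ C m :=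
  ⟨0, globalVals_zero hτ h₀ m, fun z => by rw [Pi.zero_apply, map_zero, zero_mul]⟩

theorem chartVals_add (m : ℕ) : ∀ f ∈ chartVals hτ h₀ C m, ∀ g ∈ chartVals hτ h₀ C m,
    f + g ∈ chartVals hτ h₀ C m := by
  rintro f ⟨y, hy, hf⟩ g ⟨y', hy', hg⟩
  refine ⟨y + y', globalVals_add hτ h₀ hy hy', fun z => ?_⟩
  rw [Pi.add_apply, map_add, add_mul, ← hf, ← hg]

theorem chartVals_mul (hL : IsLineBundle L) (m : ℕ) : ∀ f ∈ chartVals hτ h₀ C m,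
    ∀ m', ∀ g ∈ chartVals hτ h₀ C m', f * g ∈ chartVals hτ h₀ C (m + m') := by
  rintro f ⟨y, hy, hf⟩ m' g ⟨y', hy', hg⟩
  refine ⟨y * y', globalVals_mul hτ h₀ hL hy hy', fun z => ?_⟩
  rw [Pi.mul_apply, map_mul, pow_add, mul_mul_mul_comm, ← hf, ← hg]

theorem chartVals_pow (hL : IsLineBundle L) (m : ℕ) : ∀ f ∈ chartVals hτ h₀ C m,
    ∀ k : ℕ, f ^ k ∈ chartVals hτ h₀ C (m * k) := by
  rintro f ⟨y, hy, hf⟩ k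
  refine ⟨y ^ k, globalVals_pow hτ h₀ hL hy k, fun z => ?_⟩
  rw [Pi.pow_apply, map_pow, pow_mul, ← mul_pow, ← hf]

include hτ h₀ in
/-- Separation of Frobenius jets, read off in the charts. -/
theorem separatesFrobeniusJets_iff (hL : IsLineBundle L) (p m e : ℕ) (hp : p ≠ 0) :
    SeparatesFrobeniusJets p (tensorPow L m) Z e ↔
      ∀ g : ∀ z : (Z : Set X), Γ(X, (C z).U), ∃ f ∈ chartVals hτ h₀ C m,
        ∀ z, f z - g z ∈ idealPow (C z).ideal (p ^ e) := by
  refine (surjective_restrictionMap_iff (hL.tensorPow m) (Z : Set X) Z.isClosed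
    (frobeniusPower (Scheme.IdealSheafData.vanishingIdeal Z) (p ^ e))
    (fun x hx => mem_of_mem_support_frobeniusPower Z _ (pow_ne_zero e hp) x hx)
    (fun z => (C z).U) (fun z => (C z).isAffineOpen) (fun z => (C z).mem)
    (fun z => (C z).eq_of_mem) (fun z => powSection L (C z).t m)
    (fun z => (C z).isFrame.powSection m)).trans ?_
  refine forall_congr' fun g => ⟨?_, ?_⟩
  · rintro ⟨s, hs⟩
    choose f hf hfg using hs
    refine ⟨f, ⟨_, ⟨s, rfl⟩, fun z => ?_⟩, hfg⟩
    simp only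
    rw [← val_res (hτ.powSection m) h₀ le_top (C z).genericPoint_mem, hf, val_smul,
      val_powSection]
    rfl
  · rintro ⟨f, ⟨_, ⟨s, rfl⟩, hf⟩, hfg⟩
    exact ⟨s, fun z => ⟨f z, res_eq_smul_of_val_eq hτ h₀ hL s (C z).t (C z).genericPoint_mem
      (f z) (hf z), hfg z⟩⟩

include C in
/-- If `L ^ m` separates `p ^ e`-Frobenius jets and `L ^ m'` separates `p ^ e'`-Frobenius jets, then
`L ^ (m' + m * p ^ e')` separates `p ^ (e + e')`-Frobenius jets. -/
theorem SeparatesFrobeniusJets.add (hL : IsLineBundle L) (hZ : (Z : Set X).Finite) (p : ℕ)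
    [hp : Fact p.Prime] (hchar : ∀ z, CharP Γ(X, (C z).U) p) (hfg : ∀ z, (C z).ideal.FG)
    {m m' e e' : ℕ} (h : SeparatesFrobeniusJets p (tensorPow L m) Z e)
    (h' : SeparatesFrobeniusJets p (tensorPow L m') Z e') :
    SeparatesFrobeniusJets p (tensorPow L (m' + m * p ^ e')) Z (e + e') := by
  obtain ⟨U₀, h₀, τ, hτ⟩ := hL (genericPoint X)
  rw [separatesFrobeniusJets_iff hτ h₀ C hL p _ _ hp.out.ne_zero] at h h' ⊢
  have := hZ.to_subtype
  have : ∀ z, ExpChar Γ(X, (C z).U) p := fun z => .prime hp.out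
  exact exists_sub_mem_idealPow_add p (fun z => (C z).ideal) hfg (chartVals hτ h₀ C)
    (chartVals_zero hτ h₀ C) (chartVals_add hτ h₀ C) (chartVals_mul hτ h₀ C hL)
    (chartVals_pow hτ h₀ C hL) h h'

include C in
/-- If `L ^ m` separates `p ^ e`-Frobenius jets, then `L ^ (m * (1 + q + ⋯ + q ^ r))` separates
`q ^ (r + 1)`-Frobenius jets, where `q = p ^ e`. -/
theorem SeparatesFrobeniusJets.geom_sum (hL : IsLineBundle L) (hZ : (Z : Set X).Finite) (p : ℕ)
    [Fact p.Prime] (hchar : ∀ z, CharP Γ(X, (C z).U) p) (hfg : ∀ z, (C z).ideal.FG)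
    {m e : ℕ} (h : SeparatesFrobeniusJets p (tensorPow L m) Z e) (r : ℕ) :
    SeparatesFrobeniusJets p (tensorPow L (m * ∑ i ∈ Finset.range (r + 1), (p ^ e) ^ i)) Z
      (e * (r + 1)) := by
  induction r with
  | zero => simpa using h
  | succ r ih =>
    have := h.add C hL hZ p hchar hfg ih
    have h1 : m * ∑ i ∈ Finset.range (r + 1), (p ^ e) ^ i + m * p ^ (e * (r + 1)) =
        m * ∑ i ∈ Finset.range (r + 1 + 1), (p ^ e) ^ i := by
      rw [pow_mul, Finset.sum_range_succ _ (r + 1), mul_add]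
    have h2 : e + e * (r + 1) = e * (r + 1 + 1) := by ring
    rwa [h1, h2] at this

end Charts

/-! ### Finiteness over the ground field -/

attribute [local instance] MvPolynomial.gradedAlgebra in
theorem locallyOfFiniteType_projSpaceToSpec (k : Type u) [Field k] (n : ℕ) :
    LocallyOfFiniteType (projSpaceToSpec k n) := by
  let 𝒜 := MvPolynomial.homogeneousSubmodule (Fin (n + 1)) k
  have : IsScalarTower k (𝒜 0) (MvPolynomial (Fin (n + 1)) k) :=
    ⟨fun a x y => smul_mul_assoc a x.1 y⟩
  have : Algebra.FiniteType (𝒜 0) (MvPolynomial (Fin (n + 1)) k) :=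
    Algebra.FiniteType.of_restrictScalars_finiteType k _ _
  have h1 : LocallyOfFiniteType (Proj.toSpecZero 𝒜) := inferInstance
  have h2 : LocallyOfFiniteType
      (Spec.map (CommRingCat.ofHom (algebraMap k (𝒜 0)))) := by
    rw [HasRingHomProperty.Spec_iff (P := @LocallyOfFiniteType)]
    refine RingHom.FiniteType.of_surjective _ ?_
    -- Homogeneous polynomials of degree `0` are constants.
    rintro ⟨x, hx⟩
    have hx0 : x.totalDegree = 0 := by
      have := MvPolynomial.IsHomogeneous.totalDegree_le
        ((MvPolynomial.mem_homogeneousSubmodule 0 x).1 hx)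
      omega
    refine ⟨x.coeff 0, Subtype.ext ?_⟩
    exact (MvPolynomial.totalDegree_eq_zero_iff_eq_C.1 hx0).symm
  exact MorphismProperty.comp_mem (@LocallyOfFiniteType) _ _ h1 h2

theorem IsProjective.locallyOfFiniteType {k : Type u} [Field k] {X : Scheme.{u}}
    {f : X ⟶ Spec (.of k)} (h : IsProjective f) : LocallyOfFiniteType f := by
  obtain ⟨n, i, hi, rfl⟩ := h
  have := locallyOfFiniteType_projSpaceToSpec k n
  infer_instance

section Constants

variable {k : Type u} [Field k] (f : X ⟶ Spec (.of k))

/-- The constants, as functions on an open set of a scheme over `k`. -/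
def const (U : X.Opens) : k →+* Γ(X, U) :=
  (resO le_top).comp (f.appTop.hom.comp (Scheme.ΓSpecIso (.of k)).inv.hom)

theorem finiteType_const [LocallyOfFiniteType f] {U : X.Opens} (hU : IsAffineOpen U) :
    (const f U).FiniteType := by
  have h1 : (f.appLE ⊤ U le_top).hom.FiniteType :=
    f.finiteType_appLE (isAffineOpen_top _) hU le_top
  have h2 : (Scheme.ΓSpecIso (.of k)).inv.hom.FiniteType :=
    RingHom.FiniteType.of_surjective _
      (Scheme.ΓSpecIso (.of k)).symm.commRingCatIsoToRingEquiv.surjective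
  exact h1.comp h2

theorem isNoetherianRing_of_isAffineOpen [LocallyOfFiniteType f] {U : X.Opens}
    (hU : IsAffineOpen U) : IsNoetherianRing Γ(X, U) := by
  let := (const f U).toAlgebra
  have : Algebra.FiniteType k Γ(X, U) := finiteType_const f hU
  exact Algebra.FiniteType.isNoetherianRing k _

theorem toK_const [IsIntegral X] {U : X.Opens} (hU : genericPoint X ∈ U) (c : k) :
    toK hU (const f U c) = toK (U := ⊤) trivial (const f ⊤ c) :=
  (toK_resO le_top hU _).trans (toK_resO (V := ⊤) le_top trivial _).symm

variable {L : X.Modules} {Z : Closeds X}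

/-- The ideal of a closed point is contained in no other prime ideal. -/
theorem Chart.eq_ideal_of_le {z : X} (hz : z ∈ Z) (hzc : IsClosed ({z} : Set X))
    (C : Chart L Z z) (P : Ideal Γ(X, C.U)) [hP : P.IsPrime] (h : C.ideal ≤ P) : P = C.ideal := by
  let y : Spec Γ(X, C.U) := ⟨P, hP⟩
  have key : ∀ g, C.isAffineOpen.fromSpec y ∈ X.basicOpen g ↔ g ∉ P := by
    intro g
    change y ∈ C.isAffineOpen.fromSpec ⁻¹ᵁ X.basicOpen g ↔ _
    rw [C.isAffineOpen.fromSpec_preimage_basicOpen]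
    exact Iff.rfl
  have hyU : C.isAffineOpen.fromSpec y ∈ C.U := by
    have : C.isAffineOpen.fromSpec y ∈ Set.range C.isAffineOpen.fromSpec := ⟨y, rfl⟩
    rwa [C.isAffineOpen.range_fromSpec] at this
  have hyz : C.isAffineOpen.fromSpec y = z := by
    by_contra hne
    let V : X.Opens := ⟨{z}ᶜ, hzc.isOpen_compl⟩
    obtain ⟨g, hgV, hyg⟩ := C.isAffineOpen.exists_basicOpen_le (V := V) ⟨_, hne⟩ hyU
    refine (key g).1 hyg (h ?_)
    rw [C.mem_ideal_iff hz]
    exact fun hzg => hgV hzg rfl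
  ext g
  have hg := key g
  rw [hyz] at hg
  rw [C.mem_ideal_iff hz, hg, not_not]

/-- Modulo a Frobenius power of the ideal of a closed point, the coordinate ring of a chart is
finite over the ground field: it is of finite type and its only prime ideal is maximal. -/
theorem Chart.exists_finite_spanning [LocallyOfFiniteType f] {z : X} (hz : z ∈ Z)
    (hzc : IsClosed ({z} : Set X)) (C : Chart L Z z) (q : ℕ) :
    ∃ (n : ℕ) (b : Fin n → Γ(X, C.U)), ∀ g, ∃ c : Fin n → k,
      ∑ i, const f C.U (c i) * b i - g ∈ idealPow C.ideal q := by
  let := (const f C.U).toAlgebra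
  have : Algebra.FiniteType k Γ(X, C.U) := finiteType_const f C.isAffineOpen
  set J := idealPow C.ideal q with hJ
  have hprime : ∀ P : Ideal Γ(X, C.U), P.IsPrime → J ≤ P → P = C.ideal := fun P hP hJP =>
    C.eq_ideal_of_le hz hzc P fun g hg => hP.mem_of_pow_mem q (hJP (pow_mem_idealPow hg q))
  have : Ring.KrullDimLE 0 (Γ(X, C.U) ⧸ J) := by
    refine Ring.KrullDimLE.mk₀ fun P hP => ?_
    obtain ⟨M, hM, hPM⟩ := Ideal.exists_le_maximal P hP.ne_top
    have hle : ∀ P' : Ideal (Γ(X, C.U) ⧸ J), J ≤ P'.comap (Ideal.Quotient.mk J) := by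
      intro P' g hg
      rw [Ideal.mem_comap, Ideal.Quotient.eq_zero_iff_mem.2 hg]
      exact zero_mem _
    have := hM.isPrime
    have h1 := hprime _ (P.comap_isPrime (Ideal.Quotient.mk J)) (hle P)
    have h2 := hprime _ (M.comap_isPrime (Ideal.Quotient.mk J)) (hle M)
    rwa [Ideal.comap_injective_of_surjective _ Ideal.Quotient.mk_surjective (h1.trans h2.symm)]
  have hfin : Module.Finite k (Γ(X, C.U) ⧸ J) := (Module.finite_iff_krullDimLE_zero _ _).2 this
  obtain ⟨n, s, hs⟩ := Module.Finite.exists_fin (R := k) (M := Γ(X, C.U) ⧸ J)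
  choose b hb using fun i => Ideal.Quotient.mk_surjective (s i)
  refine ⟨n, b, fun g => ?_⟩
  have hg : Ideal.Quotient.mk J g ∈ Submodule.span k (Set.range s) := by
    rw [hs]
    trivial
  obtain ⟨c, hc⟩ := (Submodule.mem_span_range_iff_exists_fun k).1 hg
  refine ⟨c, ?_⟩
  rw [← Ideal.Quotient.eq_zero_iff_mem, map_sub, ← hc, map_sum, sub_eq_zero]
  refine Finset.sum_congr rfl fun i _ => ?_
  rw [map_mul, hb, Algebra.smul_def]
  rfl

end Constants

/-! ### Ample line bundles separate Frobenius jets -/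

section Ample

variable [IsIntegral X] {L : X.Modules} {Z : Closeds X}

/-- If `L` is ample, then every point `z` of a finite set `Z` of closed points has a chart that is
the nonvanishing locus of a global section of some positive power of `L`. -/
theorem IsAmple.exists_chart (hL : IsLineBundle L) (hample : IsAmple L)
    (hZfin : (Z : Set X).Finite) (hZclosed : ∀ x ∈ Z, IsClosed ({x} : Set X)) (z : X) :
    ∃ (C : Chart L Z z) (n : ℕ) (_ : 1 ≤ n) (s : Γ(tensorPow L n, ⊤)),
      nonvanishing (tensorPow L n) s = C.U := by
  have := hample.1
  obtain ⟨U₀, h₀, τ, hτ⟩ := hL (genericPoint X)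
  obtain ⟨n, hn, s, hzs, haff⟩ := hample.2 z
  obtain ⟨U₁, hzU₁, t, ht⟩ := hL z
  set V := nonvanishing (tensorPow L n) s with hV
  have hηV := genericPoint_mem hzs
  let G : X.Opens := ⟨((Z : Set X) \ {z})ᶜ, by
    rw [isOpen_compl_iff, ← Set.biUnion_of_singleton ((Z : Set X) \ {z})]
    exact hZfin.sdiff.isClosed_biUnion fun x hx => hZclosed x hx.1⟩
  have hzG : z ∈ G := fun h => h.2 rfl
  obtain ⟨h, hhle, hzh⟩ := haff.exists_basicOpen_le (V := U₁ ⊓ G) ⟨z, mem_inf hzU₁ hzG⟩ hzs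
  have hhV : X.basicOpen h ≤ V := X.basicOpen_le h
  let C : Chart L Z z :=
    { U := X.basicOpen h
      isAffineOpen := haff.basicOpen h
      mem := hzh
      eq_of_mem := fun x hx hxZ => by
        by_contra hxz
        exact (hhle hx).2 ⟨hxZ, hxz⟩
      t := res L (hhle.trans inf_le_left) t
      isFrame := ht.mono _ }
  obtain ⟨k₀, hk₀⟩ := exists_forall_mul_pow_mem_globalVals hτ h₀ hL s hV.symm hηV h
  set y := val (hτ.powSection n) h₀ (V := ⊤) trivial s with hy
  obtain ⟨σ, hσ⟩ := hk₀ (k₀ + 1) (Nat.le_succ k₀)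
  refine ⟨C, n * (k₀ + 1), Nat.mul_pos hn (Nat.succ_pos k₀), σ, ?_⟩
  -- The factor `s` in `h * s ^ k₀ * s` makes the section vanish outside `V`.
  have hloc : ∀ (W : X.Opens) (t : Γ(L, W)), IsFrame L W t → ∀ x ∈ W,
      (x ∈ nonvanishing (tensorPow L (n * (k₀ + 1))) σ → x ∈ V) ∧
      ∀ hWV : W ≤ V, x ∈ nonvanishing (tensorPow L (n * (k₀ + 1))) σ ↔ x ∈ X.basicOpen h := by
    intro W t ht x hx
    have hηW := genericPoint_mem hx
    obtain ⟨f, hf, hyf⟩ := exists_toK_mul_of_section hτ h₀ s ht hηW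
    rw [← hy] at hyf
    have hVf := mem_nonvanishing_iff s (ht.powSection n) hf hx
    constructor
    · intro hxσ
      obtain ⟨g, hg⟩ := exists_toK_mul_eq hτ h₀ (hk₀ k₀ le_rfl) ht hηW
      have hσ' : res _ le_top σ = (g * f) • powSection L t (n * (k₀ + 1)) := by
        refine res_eq_smul_of_val_eq hτ h₀ hL σ t hηW _ ?_
        simp only at hσ
        rw [hσ, pow_succ, ← mul_assoc, hg, hyf, map_mul]
        ring
      rw [mem_nonvanishing_iff σ (ht.powSection _) hσ' hx, Scheme.basicOpen_mul] at hxσ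
      exact hVf.2 hxσ.2
    · intro hWV
      have hσ' : res _ le_top σ =
          (resO hWV h * f ^ (k₀ + 1)) • powSection L t (n * (k₀ + 1)) := by
        refine res_eq_smul_of_val_eq hτ h₀ hL σ t hηW _ ?_
        simp only at hσ
        rw [hσ, hyf, map_mul, toK_resO, map_pow]
        ring
      rw [mem_nonvanishing_iff σ (ht.powSection _) hσ' hx, Scheme.basicOpen_mul,
        Scheme.basicOpen_pow _ _ (Nat.succ_pos k₀)]
      have h1 : X.basicOpen (resO hWV h) = W ⊓ X.basicOpen h :=
        X.basicOpen_res h (homOfLE hWV).op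
      rw [h1]
      exact ⟨fun H => H.1.2, fun H => mem_inf (mem_inf hx H) (hVf.1 (hWV hx))⟩
  have hσV : ∀ x, x ∈ nonvanishing (tensorPow L (n * (k₀ + 1))) σ → x ∈ V := by
    intro x hx
    obtain ⟨W, hxW, t, ht⟩ := hL x
    exact (hloc W t ht x hxW).1 hx
  have hiff : ∀ x ∈ V,
      (x ∈ nonvanishing (tensorPow L (n * (k₀ + 1))) σ ↔ x ∈ X.basicOpen h) := by
    intro x hx
    obtain ⟨W, hxW, t, ht⟩ := hL x
    exact (hloc (W ⊓ V) _ (ht.mono inf_le_left) x (mem_inf hxW hx)).2 inf_le_right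
  refine Opens.ext (Set.ext fun x => ⟨fun hx => ?_, fun hx => ?_⟩)
  · exact (hiff x (hσV x hx)).1 hx
  · exact (hiff x (hhV hx)).2 hx

variable {U₀ : X.Opens} {τ : Γ(L, U₀)} (hτ : IsFrame L U₀ τ) (h₀ : genericPoint X ∈ U₀)
  (C : ∀ z : (Z : Set X), Chart L Z z)

theorem chartVals_sum (m : ℕ) {ι : Type*} (A : Finset ι)
    (F : ι → ∀ z : (Z : Set X), Γ(X, (C z).U)) (hF : ∀ i ∈ A, F i ∈ chartVals hτ h₀ C m) :
    ∑ i ∈ A, F i ∈ chartVals hτ h₀ C m :=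
  Finset.sum_induction F (· ∈ chartVals hτ h₀ C m)
    (fun a b ha hb => chartVals_add hτ h₀ C m a ha b hb) (chartVals_zero hτ h₀ C m) hF

theorem chartVals_const {k : Type u} [Field k] (f : X ⟶ Spec (.of k)) (c : k) {m : ℕ}
    {F : ∀ z : (Z : Set X), Γ(X, (C z).U)}
    (hF : F ∈ chartVals hτ h₀ C m) :
    (fun z => const f (C z).U c * F z) ∈ chartVals hτ h₀ C m := by
  obtain ⟨y, hy, hF⟩ := hF
  refine ⟨_, globalVals_smul hτ h₀ hy (const f ⊤ c), fun z => ?_⟩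
  rw [map_mul, toK_const, mul_assoc, ← hF]

variable {k : Type u} [Field k] (f : X ⟶ Spec (.of k)) [LocallyOfFiniteType f]

include f in
/-- If a chart at `z` is the nonvanishing locus of a section of `L ^ n`, then for large `N` the
sections of `L ^ (n * N)` realize all Frobenius jets at `z` that are trivial at the other points
of `Z`. -/
theorem exists_forall_chartVals_sub_mem [CompactSpace X] (hL : IsLineBundle L)
    (hZclosed : ∀ x ∈ Z, IsClosed ({x} : Set X)) (z : (Z : Set X)) {n : ℕ}
    (s : Γ(tensorPow L n, ⊤)) (hs : nonvanishing (tensorPow L n) s = (C z).U) (q : ℕ) :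
    ∃ N₀ : ℕ, ∀ N, N₀ ≤ N → ∀ g : Γ(X, (C z).U), ∃ F ∈ chartVals hτ h₀ C (n * N),
      F z - g ∈ idealPow (C z).ideal q ∧ ∀ z' ≠ z, F z' ∈ idealPow (C z').ideal q := by
  set y := val (hτ.powSection n) h₀ (V := ⊤) trivial s with hy
  have hloc := fun z' => exists_toK_mul_of_section hτ h₀ s (C z').isFrame (C z').genericPoint_mem
  choose u hu hyu using hloc
  -- In the chart at `z'`, the section `s` is `u z' • t ^ n`.
  have hunit : IsUnit (u z) := by
    refine RingedSpace.isUnit_of_isUnit_germ X.toRingedSpace (C z).U (u z) fun x hx => ?_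
    rw [← Scheme.mem_basicOpen X (u z) x hx,
      ← mem_nonvanishing_iff s ((C z).isFrame.powSection n) (hu z) hx, hs]
    exact hx
  have hmem : ∀ z' ≠ z, u z' ∈ (C z').ideal := by
    intro z' hz'
    rw [(C z').mem_ideal_iff z'.2,
      ← mem_nonvanishing_iff s ((C z').isFrame.powSection n) (hu z') (C z').mem, hs]
    exact fun h => hz' (Subtype.ext ((C z).eq_of_mem _ h z'.2))
  obtain ⟨r, b, hb⟩ := (C z).exists_finite_spanning f z.2 (hZclosed z z.2) q
  have hext : ∀ i, ∃ K : ℕ, ∀ N, K ≤ N → ∃ F ∈ chartVals hτ h₀ C (n * N),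
      F z = b i * u z ^ N ∧ ∀ z' ≠ z, F z' ∈ idealPow (C z').ideal q := by
    intro i
    obtain ⟨K, hK⟩ :=
      exists_forall_mul_pow_mem_globalVals hτ h₀ hL s hs (C z).genericPoint_mem (b i)
    obtain ⟨F₀, -, hF₀⟩ := exists_mem_chartVals hτ h₀ C (hK K le_rfl)
    refine ⟨K + q, fun N hN => ?_⟩
    obtain ⟨F, hF, hFy⟩ := exists_mem_chartVals hτ h₀ C (hK N ((Nat.le_add_right K q).trans hN))
    have cancel : ∀ (z') (a : Γ(X, (C z').U)),
        toK (C z').genericPoint_mem (F z') * (C z').coeff hτ h₀ ^ (n * N) =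
          toK (C z').genericPoint_mem a * (C z').coeff hτ h₀ ^ (n * N) → F z' = a :=
      fun z' a h => toK_injective _
        (mul_right_cancel₀ (pow_ne_zero _ ((C z').coeff_ne_zero hτ h₀)) h)
    refine ⟨F, hF, cancel z _ ?_, fun z' hz' => ?_⟩
    · rw [← hFy z, hyu z, map_mul, map_pow, mul_pow, ← pow_mul, ← mul_assoc]
      rfl
    -- At `z'` the section vanishes, and the first `K` of its `N` factors absorb the poles of `b i`.
    · have h1 : F z' = F₀ z' * u z' ^ (N - K) := by
        refine cancel z' _ ?_
        have hN' : K + (N - K) = N := by omega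
        rw [← hFy z', ← hN', pow_add _ K, ← mul_assoc, hF₀ z', hyu z', Nat.add_sub_cancel_left,
          map_mul, map_pow, mul_pow, ← pow_mul, mul_add, pow_add]
        change _ * (_ * (C z').coeff hτ h₀ ^ _) = _
        ring
      have hN' : N - K = q + (N - K - q) := by omega
      rw [h1, hN', pow_add, mul_left_comm]
      exact Ideal.mul_mem_right _ _ (pow_mem_idealPow (hmem z' hz') q)
  choose K hK using hext
  refine ⟨Finset.univ.sup K, fun N hN g => ?_⟩
  choose F hF hFz hFz' using fun i => hK i N ((Finset.le_sup (Finset.mem_univ i)).trans hN)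
  obtain ⟨v, hv⟩ := hunit.pow N
  obtain ⟨c, hc⟩ := hb (g * ↑v⁻¹)
  refine ⟨∑ i, fun z' => const f (C z').U (c i) * F i z', chartVals_sum hτ h₀ C _ _ _ fun i _ =>
    chartVals_const hτ h₀ C f (c i) (hF i), ?_, fun z' hz' => ?_⟩
  · have h1 : (∑ i, fun z' => const f (C z').U (c i) * F i z') z - g =
        (∑ i, const f (C z).U (c i) * b i - g * ↑v⁻¹) * v := by
      rw [sub_mul, mul_assoc, Units.inv_mul, mul_one, Finset.sum_apply, Finset.sum_mul]
      congr 1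
      refine Finset.sum_congr rfl fun i _ => ?_
      rw [hFz, hv, mul_assoc]
    rw [h1]
    exact Ideal.mul_mem_right _ _ hc
  · rw [Finset.sum_apply]
    exact sum_mem fun i _ => Ideal.mul_mem_left _ _ (hFz' i z' hz')

include f in
/-- A power of an ample line bundle separates Frobenius jets. -/
theorem IsAmple.exists_separatesFrobeniusJets (hL : IsLineBundle L) (hample : IsAmple L)
    (hZfin : (Z : Set X).Finite) (hZclosed : ∀ x ∈ Z, IsClosed ({x} : Set X))
    (C : ∀ z : (Z : Set X), Chart L Z z) (n : ∀ _ : (Z : Set X), ℕ) (hn : ∀ z, 1 ≤ n z)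
    (s : ∀ z, Γ(tensorPow L (n z), ⊤))
    (hs : ∀ z, nonvanishing (tensorPow L (n z)) (s z) = (C z).U) (p : ℕ) (hp : p ≠ 0) (e : ℕ) :
    ∃ m : ℕ, 1 ≤ m ∧ SeparatesFrobeniusJets p (tensorPow L m) Z e := by
  classical
  have := hample.1
  obtain ⟨U₀, h₀, τ, hτ⟩ := hL (genericPoint X)
  have := hZfin.fintype
  choose N₀ hN₀ using fun z =>
    exists_forall_chartVals_sub_mem hτ h₀ C f hL hZclosed z (s z) (hs z) (p ^ e)
  -- The exponent has to be a multiple of every `n z`, with a quotient of at least `N₀ z`.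
  set P := ∏ z, n z with hP
  set M := Finset.univ.sup N₀ + 1 with hM
  have hP0 : 1 ≤ P := Finset.one_le_prod' fun z _ => hn z
  refine ⟨P * M, Nat.mul_pos hP0 (Nat.succ_pos _), ?_⟩
  rw [separatesFrobeniusJets_iff hτ h₀ C hL p _ _ hp]
  intro g
  have hz : ∀ z, ∃ F ∈ chartVals hτ h₀ C (P * M), F z - g z ∈ idealPow (C z).ideal (p ^ e) ∧
      ∀ z' ≠ z, F z' ∈ idealPow (C z').ideal (p ^ e) := by
    intro z
    obtain ⟨d, hd⟩ : n z ∣ P := Finset.dvd_prod_of_mem n (Finset.mem_univ z)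
    have hd0 : 1 ≤ d := by
      rcases Nat.eq_zero_or_pos d with h0 | h0
      · rw [hd, h0, mul_zero] at hP0
        exact absurd hP0 (by norm_num)
      · exact h0
    have hle : N₀ z ≤ d * M :=
      (Finset.le_sup (f := N₀) (Finset.mem_univ z)).trans
        ((Nat.le_succ _).trans (Nat.le_mul_of_pos_left M hd0))
    rw [hd, mul_assoc]
    exact hN₀ z _ hle (g z)
  choose F hF hFz hFz' using hz
  refine ⟨∑ z, F z, chartVals_sum hτ h₀ C _ _ _ fun z _ => hF z, fun z => ?_⟩
  rw [Finset.sum_apply, ← Finset.add_sum_erase _ _ (Finset.mem_univ z), add_sub_right_comm]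
  exact add_mem (hFz z) (sum_mem fun z' hz' => hFz' z' z (Finset.ne_of_mem_erase hz').symm)

end Ample

/-! ### Suprema of ratios -/

theorem ratio_eq_ofReal (p e : ℕ) {m : ℕ} (hm : 1 ≤ m) :
    ((p : ENNReal) ^ e - 1) / (m : ENNReal) = ENNReal.ofReal (((p : ℝ) ^ e - 1) / m) := by
  have hm' : (0 : ℝ) < m := by exact_mod_cast hm
  rw [ENNReal.ofReal_div_of_pos hm', ENNReal.ofReal_sub _ zero_le_one,
    ENNReal.ofReal_pow (Nat.cast_nonneg p), ENNReal.ofReal_natCast, ENNReal.ofReal_natCast,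
    ENNReal.ofReal_one]

theorem ratio_nonneg {p : ℕ} (hp : 1 ≤ p) (e m : ℕ) : 0 ≤ ((p : ℝ) ^ e - 1) / m :=
  div_nonneg (sub_nonneg.2 (one_le_pow₀ (by exact_mod_cast hp))) (Nat.cast_nonneg m)

/-- The exponents of `SeparatesFrobeniusJets.geom_sum` have the same ratio as `m` and `e`. -/
theorem geom_ratio_eq {p : ℕ} (hp : 2 ≤ p) {e m : ℕ} (r : ℕ) :
    ((p : ℝ) ^ (e * (r + 1)) - 1) / ((m * ∑ i ∈ Finset.range (r + 1), (p ^ e) ^ i : ℕ) : ℝ) =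
      ((p : ℝ) ^ e - 1) / m := by
  have h := geom_sum_mul ((p : ℝ) ^ e) (r + 1)
  have hpos : (0 : ℝ) < ∑ i ∈ Finset.range (r + 1), ((p : ℝ) ^ e) ^ i :=
    Finset.sum_pos (fun i _ => by positivity) ⟨0, by simp⟩
  push_cast
  rw [pow_mul, ← h, mul_comm (m : ℝ), mul_div_mul_left _ _ hpos.ne']

variable {L : X.Modules} {Z : Closeds X} {p : ℕ}

theorem toENNReal_pow_sub_one (p e : ℕ) :
    (((p : ℕ∞) ^ (e : ℕ∞) - 1 : ℕ∞) : ENNReal) = (p : ENNReal) ^ e - 1 := by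
  rw [ENat.epow_natCast, ENat.toENNReal_sub, ENat.toENNReal_pow, ENat.toENNReal_coe,
    ENat.toENNReal_one]

theorem ratio_le_jetRatio (hp : 1 ≤ p) {m e : ℕ} (he : 1 ≤ e)
    (h : SeparatesFrobeniusJets p (tensorPow L m) Z e) :
    ((p : ENNReal) ^ e - 1) / (m : ENNReal) ≤ jetRatio p L Z m := by
  have h1 : (e : ℕ∞) ≤ sF p (tensorPow L m) Z := le_iSup₂_of_le e ⟨he, h⟩ le_rfl
  have hp0 : (p : ℕ∞) ≠ 0 := by exact_mod_cast (by omega : p ≠ 0)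
  have h2 : (p : ℕ∞) ^ (e : ℕ∞) ≤ (p : ℕ∞) ^ sF p (tensorPow L m) Z :=
    ENat.epow_right_mono hp0 h1
  rw [← toENNReal_pow_sub_one]
  exact ENNReal.div_le_div_right (ENat.toENNReal_le.2 (tsub_le_tsub_right h2 1)) _

theorem jetRatio_le_of_forall {m : ℕ} (hm : 1 ≤ m) (hp : 2 ≤ p) {c : ENNReal}
    (h : ∀ e, 1 ≤ e → SeparatesFrobeniusJets p (tensorPow L m) Z e →
      ((p : ENNReal) ^ e - 1) / (m : ENNReal) ≤ c) : jetRatio p L Z m ≤ c := by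
  have hm0 : (m : ENNReal) ≠ 0 := by exact_mod_cast (by omega : m ≠ 0)
  by_cases hbdd : ∃ N : ℕ, ∀ e, 1 ≤ e → SeparatesFrobeniusJets p (tensorPow L m) Z e → e ≤ N
  · rw [jetRatio]
    by_cases hne : ∃ e, 1 ≤ e ∧ SeparatesFrobeniusJets p (tensorPow L m) Z e
    · classical
      obtain ⟨N, hN⟩ := hbdd
      obtain ⟨e, ⟨he, hs⟩, hmax⟩ : ∃ e, (1 ≤ e ∧ SeparatesFrobeniusJets p (tensorPow L m) Z e) ∧
          ∀ e', 1 ≤ e' ∧ SeparatesFrobeniusJets p (tensorPow L m) Z e' → e' ≤ e := by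
        have hfin : {e | 1 ≤ e ∧ SeparatesFrobeniusJets p (tensorPow L m) Z e}.Finite :=
          (Set.finite_Iic N).subset fun e he => hN e he.1 he.2
        obtain ⟨e, he, hmax⟩ := Set.exists_max_image _ id hfin hne
        exact ⟨e, he, hmax⟩
      have hsF : sF p (tensorPow L m) Z = (e : ℕ∞) :=
        le_antisymm (iSup₂_le fun e' he' => by exact_mod_cast hmax e' he')
          (le_iSup₂_of_le e ⟨he, hs⟩ le_rfl)
      rw [hsF, toENNReal_pow_sub_one]
      exact h e he hs
    · have hsF : sF p (tensorPow L m) Z = 0 :=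
        le_antisymm (iSup₂_le fun e he => (hne ⟨e, he⟩).elim) zero_le
      simp [hsF]
  -- If `e` is unbounded, so are the ratios, because `p ^ e > e`.
  · push Not at hbdd
    have hc : c = ⊤ := by
      refine ENNReal.eq_top_of_forall_nnreal_le fun r => ?_
      obtain ⟨N, hN⟩ := exists_nat_ge (r * m)
      obtain ⟨e, he, hs, hNe⟩ := hbdd N
      refine le_trans ?_ (h e he hs)
      have hlt : N + 1 ≤ p ^ e := (hNe.le.trans_lt (Nat.lt_pow_self (by omega)))
      rw [ENNReal.le_div_iff_mul_le (Or.inl hm0) (Or.inl (ENNReal.natCast_ne_top m))]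
      refine ENNReal.le_sub_of_add_le_right ENNReal.one_ne_top ?_
      have h1 : ((r : ENNReal) * m) ≤ N := by exact_mod_cast hN
      calc (r : ENNReal) * m + 1 ≤ N + 1 := by gcongr
        _ ≤ (p : ENNReal) ^ e := by exact_mod_cast hlt
    rw [hc]
    exact le_top

theorem epsilonF_eq_iSup (hp : 2 ≤ p) :
    epsilonF p L Z = ⨆ (m : ℕ) (e : ℕ) (_ : 1 ≤ m ∧ 1 ≤ e ∧ SeparatesFrobeniusJets p
      (tensorPow L m) Z e), ((p : ENNReal) ^ e - 1) / (m : ENNReal) := by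
  apply le_antisymm
  · refine iSup₂_le fun m hm => jetRatio_le_of_forall hm hp fun e he h => ?_
    exact le_iSup_of_le m (le_iSup₂_of_le e ⟨hm, he, h⟩ le_rfl)
  · refine iSup_le fun m => iSup₂_le fun e h => ?_
    exact (ratio_le_jetRatio (by omega) h.2.1 h.2.2).trans (le_iSup₂_of_le m h.1 le_rfl)

end FrobeniusSeshadri

end

open FrobeniusSeshadri in
theorem proposition2p3
    {k : Type u} [Field k] [IsAlgClosed k] (p : ℕ) [Fact p.Prime] [CharP k p]
    {X : Scheme.{u}} [IsIntegral X] (f : X ⟶ Spec (.of k))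
    (hX : FrobeniusSeshadri.IsProjective f)
    (L : X.Modules) (hL : FrobeniusSeshadri.IsLineBundle L) (hample : FrobeniusSeshadri.IsAmple L)
    (Z : Closeds X) (hZfin : (Z : Set X).Finite) (hZclosed : ∀ x ∈ Z, IsClosed ({x} : Set X))
    (hZsmooth : ∀ x ∈ Z, FrobeniusSeshadri.IsSmoothPoint f x) :
    (FrobeniusSeshadri.epsilonF p L Z =
      ⨆ (m : ℕ) (e : ℕ) (_ : 1 ≤ m ∧ 1 ≤ e ∧ FrobeniusSeshadri.SeparatesFrobeniusJets p
        (FrobeniusSeshadri.tensorPow L m) Z e), ((p : ENNReal) ^ e - 1) / (m : ENNReal)) ∧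
    (∀ a : ℝ, (a : EReal) < (FrobeniusSeshadri.epsilonF p L Z : EReal) →
      ∃ e₀ : ℕ, 1 ≤ e₀ ∧ ∀ e : ℕ, 1 ≤ e → e₀ ∣ e →
        ∃ m : ℕ, 1 ≤ m ∧
          FrobeniusSeshadri.SeparatesFrobeniusJets p (FrobeniusSeshadri.tensorPow L m) Z e ∧
          a < ((p : ℝ) ^ e - 1) / (m : ℝ)) ∧
    FrobeniusSeshadri.epsilonF p L Z =
      Filter.limsup (fun m : ℕ => FrobeniusSeshadri.jetRatio p L Z m) Filter.atTop := by
  have hp : 2 ≤ p := (Fact.out : p.Prime).two_le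
  have hft := hX.locallyOfFiniteType
  choose C n hn s hs using fun z : (Z : Set X) => hample.exists_chart hL hZfin hZclosed z.1
  have hchar : ∀ z, CharP Γ(X, (C z).U) p := fun z => by
    have : Nonempty (C z).U := ⟨⟨z.1, (C z).mem⟩⟩
    exact charP_of_injective_ringHom (const f (C z).U).injective p
  have hfg : ∀ z, (C z).ideal.FG := fun z => by
    have := isNoetherianRing_of_isAffineOpen f (C z).isAffineOpen
    exact IsNoetherian.noetherian _
  have hpow : ∀ m e, 1 ≤ m → SeparatesFrobeniusJets p (tensorPow L m) Z e → ∀ r : ℕ,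
      ∃ m', r + 1 ≤ m' ∧ SeparatesFrobeniusJets p (tensorPow L m') Z (e * (r + 1)) ∧
        ((p : ℝ) ^ (e * (r + 1)) - 1) / (m' : ℝ) = ((p : ℝ) ^ e - 1) / m := by
    intro m e hm h r
    refine ⟨_, ?_, h.geom_sum C hL hZfin p hchar hfg r, geom_ratio_eq hp r⟩
    calc r + 1 = 1 * ∑ i ∈ Finset.range (r + 1), 1 := by simp
      _ ≤ m * ∑ i ∈ Finset.range (r + 1), (p ^ e) ^ i :=
        Nat.mul_le_mul hm (Finset.sum_le_sum fun i _ => Nat.one_le_pow _ _ (by positivity))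
  refine ⟨epsilonF_eq_iSup hp, fun a ha => ?_, le_antisymm ?_ ?_⟩
  · obtain ⟨m, e, hm, he, h, hae⟩ : ∃ m e, 1 ≤ m ∧ 1 ≤ e ∧
        SeparatesFrobeniusJets p (tensorPow L m) Z e ∧ a < ((p : ℝ) ^ e - 1) / (m : ℝ) := by
      rcases lt_or_ge a 0 with ha0 | ha0
      · obtain ⟨m, hm, h⟩ := hample.exists_separatesFrobeniusJets f hL hZfin hZclosed C n hn s hs p
          (by omega) 1
        exact ⟨m, 1, hm, le_rfl, h, ha0.trans_le (ratio_nonneg (by omega) _ _)⟩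
      · have h1 : ENNReal.ofReal a < epsilonF p L Z := by
          rw [← EReal.coe_ennreal_lt_coe_ennreal_iff, EReal.coe_ennreal_ofReal, max_eq_left ha0]
          exact ha
        rw [epsilonF_eq_iSup hp] at h1
        obtain ⟨m, hm⟩ := lt_iSup_iff.1 h1
        obtain ⟨e, he⟩ := lt_iSup_iff.1 hm
        obtain ⟨h, hlt⟩ := lt_iSup_iff.1 he
        rw [ratio_eq_ofReal p e h.1, ENNReal.ofReal_lt_ofReal_iff_of_nonneg ha0] at hlt
        exact ⟨m, e, h.1, h.2.1, h.2.2, hlt⟩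
    refine ⟨e, he, ?_⟩
    rintro _ he' ⟨r, rfl⟩
    obtain ⟨r, rfl⟩ := Nat.exists_eq_succ_of_ne_zero (n := r) (by rintro rfl; omega)
    obtain ⟨m', hm', h', heq⟩ := hpow m e hm h r
    exact ⟨m', by omega, h', heq.symm ▸ hae⟩
  · rw [epsilonF_eq_iSup hp]
    refine iSup_le fun m => iSup₂_le fun e h => ?_
    refine Filter.le_limsup_of_frequently_le (Filter.frequently_atTop.2 fun N => ?_)
    obtain ⟨m', hm', h', heq⟩ := hpow m e h.1 h.2.2 N
    refine ⟨m', by omega, le_trans (le_of_eq ?_)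
      (ratio_le_jetRatio (by omega) (Nat.mul_pos h.2.1 (Nat.succ_pos N)) h')⟩
    rw [ratio_eq_ofReal p _ h.1, ratio_eq_ofReal p _ (by omega), heq]
  · refine Filter.limsup_le_of_le (by isBoundedDefault) ?_
    filter_upwards [Filter.eventually_ge_atTop 1] with m hm
    exact le_iSup₂_of_le m hm le_rfl
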